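/- Let $n\in\mathbb N$, let $(\Omega_j,\Sigma_j,\mu_j)$, $1\le j\le n$, be $\sigma$-finite measure spaces with product $(\Omega,\Sigma,\mu)$, and for $z\in\{0,1\}$ let $\varphi_{zj}$ be a probability density with respect to $\mu_j$ (a probability mass function when $\mu_j$ is a counting measure). Put $\varphi_z(x)=\prod_{j=1}^n\varphi_{zj}(x_j)$, and assume that the Kullback–Leibler divergences $\int\varphi_0\log\frac{\varphi_0}{\varphi_1}\,d\mu$ and $\int\varphi_1\log\frac{\varphi_1}{\varphi_0}\,d\mu$ are both positive and finite (in particular the two laws are mutually absolutely continuous). For $\alpha\in(0,1)$ let $D_\alpha=-\log\int_\Omega\varphi_0^{1-\alpha}\varphi_1^{\alpha}\,d\mu$ be the Chernoff $\alpha$-divergence and $D^*=\sup_{\alpha\in(0,1)}D_\alpha$ the Chernoff information; let $\varphi_\alpha=\varphi_0^{1-\alpha}\varphi_1^{\alpha}e^{D_\alpha}$ and $\varphi_{\alpha j}=\varphi_{0j}^{1-\alpha}\varphi_{1j}^{\alpha}\big/\int_{\Omega_j}\varphi_{0j}^{1-\alpha}\varphi_{1j}^{\alpha}\,d\mu_j$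 be the tilted densities, $l=\varphi_0/\varphi_1$, $l_j=\varphi_{0j}/\varphi_{1j}$, and $g_\alpha(x)=\exp[\min(\alpha x,(\alpha-1)x)]$. Let $\eta(\varphi_0,\varphi_1)=\int_\Omega\min(\varphi_0,\varphi_1)\,d\mu$ be the total variation affinity. Then $\alpha\mapsto D_\alpha$ has a unique maximiser $\alpha^*$ in $(0,1)$, and $\eta(\varphi_0,\varphi_1)=2R(\hat z,z)$ for every Bayes estimator $\hat z$ (a measurable choice of $\hat z(x)\in\arg\max_{z}\varphi_z(x)$), where $R(\hat z,z)=\frac12\sum_{z\in\{0,1\}}\mathbb P_{X\sim\varphi_z}(\hat z(X)\neq z)$. Let $Y_j\sim\varphi_{\alpha^*j}$, $$Z_j=\log l_j(Y_j)-\mathbb E[\log l_j(Y_j)],\qquad \bar\sigma_n=\Big(\frac1n\sum_{j=1}^n\operatorname{Var}[Z_j]\Big)^{1/2}.$$ For every $C_1$ there are positive constants $C_2,C_3,C_4$, depending only on $C_1$, such that whenever $\sum_{j=1}^n\mathbb E|Z_j|^3\le C_1n\bar\sigma_n^2$, the following hold. 1. (Upper bound) $$\mathbb E_{Y\sim\varphi_{\alpha^*}}[g_{\alpha^*}(\log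 l(Y))]\le\frac{C_2}{\sqrt n\,\bar\sigma_n\alpha^*(1-\alpha^*)},\qquad \eta(\varphi_0,\varphi_1)\le\frac{C_2}{\sqrt n\,\bar\sigma_n\alpha^*(1-\alpha^*)}\,e^{-D^*}.$$ 2. (Lower bound) If $\sqrt n\,\bar\sigma_n\alpha^*(1-\alpha^*)\ge C_3$, then $$\mathbb E_{Y\sim\varphi_{\alpha^*}}[g_{\alpha^*}(\log l(Y))]\ge\frac{C_4}{\sqrt n\,\bar\sigma_n\alpha^*(1-\alpha^*)},\qquad \eta(\varphi_0,\varphi_1)\ge\frac{C_4}{\sqrt n\,\bar\sigma_n\alpha^*(1-\alpha^*)}\,e^{-D^*}.$$ Since $\eta(\varphi_0,\varphi_1)=2R(\hat z,z)$, the same bounds hold for $2R(\hat z,z)$. -/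

import Mathlib

open MeasureTheory

noncomputable section

namespace BayesChernoff

section General

variable {X : Type*} [MeasurableSpace X]

/-- `f` is a probability density with respect to `μ`; a probability mass function is a density
with respect to a counting measure. -/
structure IsDensity (μ : Measure X) (f : X → ℝ) : Prop where
  measurable : Measurable f
  nonneg : ∀ x, 0 ≤ f x
  lintegral_eq_one : ∫⁻ x, ENNReal.ofReal (f x) ∂μ = 1

/-- The measure with density `f` with respect to `μ`. -/
def law (μ : Measure X) (f : X → ℝ) : Measure X :=
  μ.withDensity fun x => ENNReal.ofReal (f x)

/-- The Chernoff `α`-divergence `D_α(f ‖ g) = -log ∫ f ^ (1 - α) g ^ α dμ`. -/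
def chernoffDiv (μ : Measure X) (f g : X → ℝ) (α : ℝ) : ℝ :=
  -Real.log (∫ x, f x ^ (1 - α) * g x ^ α ∂μ)

/-- The Chernoff information, the supremum over `α ∈ (0, 1)` of the Chernoff `α`-divergence. -/
def chernoffInfo (μ : Measure X) (f g : X → ℝ) : ℝ :=
  sSup (chernoffDiv μ f g '' Set.Ioo 0 1)

/-- `α` is a maximiser over the open interval `(0, 1)` of the Chernoff `α`-divergence. -/
def IsChernoffArgmax (μ : Measure X) (f g : X → ℝ) (α : ℝ) : Prop :=
  α ∈ Set.Ioo (0 : ℝ) 1 ∧ IsMaxOn (chernoffDiv μ f g) (Set.Ioo 0 1) α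

/-- The tilted density `f ^ (1 - α) g ^ α exp (D_α(f ‖ g))`. -/
def tilted (μ : Measure X) (f g : X → ℝ) (α : ℝ) (x : X) : ℝ :=
  f x ^ (1 - α) * g x ^ α * Real.exp (chernoffDiv μ f g α)

/-- The log-likelihood ratio `log (f / g)`. -/
def logLR (f g : X → ℝ) (x : X) : ℝ :=
  Real.log (f x / g x)

/-- The log-likelihood ratio centred at its mean under the tilted law. -/
def centredLLR (μ : Measure X) (f g : X → ℝ) (α : ℝ) (x : X) : ℝ :=
  logLR f g x - ∫ y, logLR f g y ∂(law μ (tilted μ f g α))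

/-- The total variation affinity `∫ min (f, g) dμ`. -/
def affinity (μ : Measure X) (f g : X → ℝ) : ℝ :=
  ∫ x, min (f x) (g x) ∂μ

/-- A Bayes estimator for two equiprobable hypotheses: a measurable choice of
`argmax_z φ z x`, with an arbitrary rule for ties. -/
def IsBayesEstimator (φ : Fin 2 → X → ℝ) (zhat : X → Fin 2) : Prop :=
  Measurable zhat ∧ ∀ x z, φ z x ≤ φ (zhat x) x

/-- The error probability of `zhat`, averaged over the two hypotheses. -/
def errorProb (μ : Measure X) (φ : Fin 2 → X → ℝ) (zhat : X → Fin 2) : ℝ :=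
  (1 / 2) * ∑ z : Fin 2, (law μ (φ z)).real {x | zhat x ≠ z}

end General

/-- `g_α(x) = exp (min (α x, (α - 1) x))`. -/
def gFun (α x : ℝ) : ℝ :=
  Real.exp (min (α * x) ((α - 1) * x))

section Product

variable {n : ℕ} {Ω : Fin n → Type*}

/-- The product density `φ_z(x) = ∏ j, φ_{z j}(x_j)`. -/
def prodDensity (φ : Fin 2 → (j : Fin n) → Ω j → ℝ) (z : Fin 2) (x : (j : Fin n) → Ω j) : ℝ :=
  ∏ j, φ z j (x j)

variable [∀ j, MeasurableSpace (Ω j)]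

/-- The pairs of product densities under consideration: all the factors are probability
densities, and both Kullback-Leibler divergences between the two product laws are positive
real numbers. -/
structure InFamily (μ : (j : Fin n) → Measure (Ω j))
    (φ : Fin 2 → (j : Fin n) → Ω j → ℝ) : Prop where
  isDensity : ∀ z j, IsDensity (μ j) (φ z j)
  kl_pos : ∀ z w : Fin 2, z ≠ w →
    0 < InformationTheory.klDiv (law (Measure.pi μ) (prodDensity φ z))
      (law (Measure.pi μ) (prodDensity φ w))
  kl_lt_top : ∀ z w : Fin 2, z ≠ w →
    InformationTheory.klDiv (law (Measure.pi μ) (prodDensity φ z))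
      (law (Measure.pi μ) (prodDensity φ w)) < ⊤

/-- The law `φ_{α j}` of `Y_j`. -/
def coordLaw (μ : (j : Fin n) → Measure (Ω j)) (φ : Fin 2 → (j : Fin n) → Ω j → ℝ) (α : ℝ)
    (j : Fin n) : Measure (Ω j) :=
  law (μ j) (tilted (μ j) (φ 0 j) (φ 1 j) α)

/-- `Z_j`, as a function of the value of `Y_j`. -/
def coordZ (μ : (j : Fin n) → Measure (Ω j)) (φ : Fin 2 → (j : Fin n) → Ω j → ℝ) (α : ℝ)
    (j : Fin n) : Ω j → ℝ :=
  centredLLR (μ j) (φ 0 j) (φ 1 j) α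

/-- `σ̄_n`, the square root of the average variance of the `Z_j`. -/
def sigmaBar (μ : (j : Fin n) → Measure (Ω j)) (φ : Fin 2 → (j : Fin n) → Ω j → ℝ)
    (α : ℝ) : ℝ :=
  Real.sqrt ((1 / (n : ℝ)) *
    ∑ j, ProbabilityTheory.variance (coordZ μ φ α j) (coordLaw μ φ α j))

/-- `E_{Y ∼ φ_α} [g_α(log l(Y))]`, with `l = φ_0 / φ_1` on the product space. -/
def expG (μ : (j : Fin n) → Measure (Ω j)) (φ : Fin 2 → (j : Fin n) → Ω j → ℝ)
    (α : ℝ) : ℝ :=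
  ∫ y, gFun α (logLR (prodDensity φ 0) (prodDensity φ 1) y)
    ∂(law (Measure.pi μ) (tilted (Measure.pi μ) (prodDensity φ 0) (prodDensity φ 1) α))

end Product

end BayesChernoff

end

open MeasureTheory BayesChernoff

/-!
Tilting turns the affinity into `exp (-D_α)` times the expectation of `g_α (log l)` under the tilted
law. As `D_α` is minus the cumulant generating function of `-log l` under `φ₀`, it is strictly
concave and vanishes at `0` and `1`, so it has a unique maximiser `α*`. Its derivative, the tilted
mean of `log l`, vanishes there, so under the law tilted by `α*` the log-likelihood ratio `log l` is
the sum of the independent centred variables `Z_j`.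

The third moment condition makes the characteristic function of this sum close to that of a Gaussian
variable of standard deviation `s = √n σ̄` on a window of fixed width. Fejér kernels only see such a
window, and they dominate `g_α` up to rescaling, which gives the upper bound. Conversely a narrow
Fejér kernel minus a small multiple of wide ones minorises the indicator of an interval. Hence an
interval of length of order `1 / (α (1 - α))` next to the origin, where `g_α` is bounded below, has
probability at least of order `1 / (s α (1 - α))`.
-/

namespace BayesChernoff

open Filter ProbabilityTheory Real Set
open scoped NNReal

/-- The Fejér kernel `(sin (x / 2) / (x / 2)) ^ 2`, the Fourier transform of the triangle function.
It serves as a test function whose integrals only see a bounded window of the characteristic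
function. -/
noncomputable def fejer (x : ℝ) : ℝ := sinc (x / 2) ^ 2

theorem fejer_nonneg (x : ℝ) : 0 ≤ fejer x := sq_nonneg _

theorem fejer_le_one (x : ℝ) : fejer x ≤ 1 := (sq_le_one_iff_abs_le_one _).2 (abs_sinc_le_one _)

@[fun_prop]
theorem continuous_fejer : Continuous fejer := by
  have := continuous_sinc
  unfold fejer
  fun_prop

theorem sq_mul_fejer (x : ℝ) : x ^ 2 * fejer x = 2 * (1 - cos x) := by
  have h : x * sinc (x / 2) = 2 * sin (x / 2) := by
    rcases eq_or_ne x 0 with rfl | hx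
    · simp
    · rw [sinc_of_ne_zero (by simpa using hx)]
      field_simp
  rw [fejer, ← mul_pow, h, mul_pow, sin_sq_eq_half_sub, mul_div_cancel₀ x two_ne_zero]
  ring

theorem fejer_eq_integral (x : ℝ) : fejer x = 2 * ∫ t in (0 : ℝ)..1, (1 - t) * cos (t * x) := by
  rcases eq_or_ne x 0 with rfl | hx
  · have : ∫ t in (0 : ℝ)..1, (1 - t) = 1 / 2 := by
      rw [intervalIntegral.integral_sub (by simp) (by simp)]
      norm_num
    simp [fejer, this]
  have hderiv : ∀ t ∈ uIcc (0 : ℝ) 1, HasDerivAt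
      (fun t => (1 - t) * (sin (t * x) / x) - cos (t * x) / x ^ 2) ((1 - t) * cos (t * x)) t := by
    intro t _
    have hmul : HasDerivAt (fun t : ℝ => t * x) x t := by
      simpa using (hasDerivAt_id t).mul_const x
    have hsub : HasDerivAt (fun t : ℝ => 1 - t) (-1) t := by
      simpa using (hasDerivAt_id t).const_sub 1
    refine ((hsub.mul (hmul.sin.div_const x)).sub (hmul.cos.div_const (x ^ 2))).congr_deriv ?_
    field_simp
    ring
  have hsq := sq_mul_fejer x
  rw [intervalIntegral.integral_eq_sub_of_hasDerivAt hderiv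
    (Continuous.intervalIntegrable (by fun_prop) _ _)]
  simp only [one_mul, zero_mul, sub_self, sub_zero, cos_zero, sin_zero, zero_div, mul_zero]
  field_simp
  linarith

theorem two_fifths_le_fejer {x : ℝ} (hx : |x| ≤ π) : 2 / 5 ≤ fejer x := by
  rcases eq_or_ne x 0 with rfl | hx0
  · norm_num [fejer]
  have hcos : 2 / 5 * x ^ 2 ≤ 2 * (1 - cos x) := by
    have hpi : 1 / 5 ≤ 2 / π ^ 2 := by
      rw [div_le_div_iff₀ (by norm_num) (by positivity)]
      nlinarith [pi_lt_d2, pi_pos]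
    nlinarith [cos_le_one_sub_mul_cos_sq hx, sq_nonneg x]
  rw [← sq_mul_fejer, mul_comm] at hcos
  exact le_of_mul_le_mul_left hcos (by positivity)

-- Up to constants the squares of `x` and `x + π` are the same size, and the two cosines cancel.
theorem four_le_mul_fejer_add_fejer (x : ℝ) :
    4 ≤ (|x| + π) ^ 2 * (fejer x + fejer (x + π)) := by
  have hsq : x ^ 2 ≤ (|x| + π) ^ 2 := by
    rw [← sq_abs x]
    gcongr
    linarith [pi_pos]
  have hsq' : (x + π) ^ 2 ≤ (|x| + π) ^ 2 :=
    sq_le_sq' (by linarith [neg_abs_le x, pi_pos]) (by linarith [le_abs_self x])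
  calc (4 : ℝ) = x ^ 2 * fejer x + (x + π) ^ 2 * fejer (x + π) := by
        rw [sq_mul_fejer, sq_mul_fejer, cos_add_pi]
        ring
    _ ≤ (|x| + π) ^ 2 * (fejer x + fejer (x + π)) := by
        rw [mul_add]
        have := fejer_nonneg x
        have := fejer_nonneg (x + π)
        gcongr

theorem exp_neg_abs_le_fejer_add_fejer (x : ℝ) :
    exp (-|x|) ≤ 4 * (fejer x + fejer (x + π)) := by
  have hexp : (|x| + π) ^ 2 ≤ 16 * exp |x| := by
    nlinarith [quadratic_le_exp_of_nonneg (abs_nonneg x), pi_lt_four, pi_pos, abs_nonneg x]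
  have hF : 0 ≤ fejer x + fejer (x + π) := add_nonneg (fejer_nonneg _) (fejer_nonneg _)
  rw [exp_neg, inv_le_iff_one_le_mul₀ (exp_pos _)]
  linarith [four_le_mul_fejer_add_fejer x, mul_le_mul_of_nonneg_right hexp hF]

theorem sq_mul_fejer_mul_le {y : ℝ} (hy : 1 ≤ |y|) (M : ℝ) :
    M ^ 2 * fejer (M * y) ≤ 18 * (fejer y + fejer (y + π)) := by
  have hy0 : 0 < y ^ 2 := by
    rw [← sq_abs]
    positivity
  have hF : 0 ≤ fejer y + fejer (y + π) := add_nonneg (fejer_nonneg _) (fejer_nonneg _)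
  have h18 : (|y| + π) ^ 2 ≤ 18 * y ^ 2 := by
    rw [← sq_abs y]
    nlinarith [pi_lt_d2, pi_pos]
  refine le_of_mul_le_mul_left ?_ hy0
  calc y ^ 2 * (M ^ 2 * fejer (M * y)) = 2 * (1 - cos (M * y)) := by
        rw [← sq_mul_fejer]
        ring
    _ ≤ 4 := by linarith [neg_one_le_cos (M * y)]
    _ ≤ (|y| + π) ^ 2 * (fejer y + fejer (y + π)) := four_le_mul_fejer_add_fejer y
    _ ≤ 18 * y ^ 2 * (fejer y + fejer (y + π)) := by gcongr
    _ = y ^ 2 * (18 * (fejer y + fejer (y + π))) := by ring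

theorem fejer_sub_le_indicator {M : ℝ} (hM : 0 < M) (y : ℝ) :
    fejer (M * y) - 18 / M ^ 2 * (fejer y + fejer (y + π)) ≤ indicator {y | |y| ≤ 1} 1 y := by
  have hF : 0 ≤ fejer y + fejer (y + π) := add_nonneg (fejer_nonneg _) (fejer_nonneg _)
  by_cases hy : |y| ≤ 1
  · rw [indicator_of_mem (show y ∈ {y : ℝ | |y| ≤ 1} from hy), Pi.one_apply]
    have : 0 ≤ 18 / M ^ 2 * (fejer y + fejer (y + π)) := by positivity
    linarith [fejer_le_one (M * y)]
  · rw [indicator_of_notMem (show y ∉ {y : ℝ | |y| ≤ 1} from hy), sub_nonpos,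
      div_mul_eq_mul_div, le_div_iff₀ (by positivity), mul_comm]
    exact sq_mul_fejer_mul_le (not_le.1 hy).le M

section Smoothing

variable {ν ν' : Measure ℝ} [IsProbabilityMeasure ν] [IsProbabilityMeasure ν']

theorem integrable_fejer (T b : ℝ) : Integrable (fun x => fejer (T * x + b)) ν :=
  .of_bound (C := 1) (by fun_prop) <| ae_of_all _ fun x => by
    rw [norm_of_nonneg (fejer_nonneg _)]
    exact fejer_le_one _

theorem integral_cos_eq_re_charFun (u b : ℝ) :
    ∫ x, cos (u * x + b) ∂ν = (Complex.exp (b * Complex.I) * charFun ν u).re := by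
  rw [charFun_apply_real, ← integral_const_mul, ← RCLike.re_eq_complex_re, ← integral_re]
  · refine integral_congr_ae (ae_of_all _ fun x => ?_)
    simp only [RCLike.re_eq_complex_re]
    rw [← Complex.exp_add, ← add_mul, ← Complex.ofReal_mul, ← Complex.ofReal_add,
      Complex.exp_ofReal_mul_I_re, add_comm]
  · refine .of_bound (C := 1) (by fun_prop) (ae_of_all _ fun x => ?_)
    rw [norm_mul, Complex.norm_exp_ofReal_mul_I, ← Complex.ofReal_mul,
      Complex.norm_exp_ofReal_mul_I, one_mul]

theorem integrable_uncurry_fejer_integrand (T b : ℝ) :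
    Integrable (Function.uncurry fun x t : ℝ => (1 - t) * cos (t * (T * x + b)))
      (ν.prod (volume.restrict (Ioc 0 1))) := by
  have hmem : ∀ᵐ z ∂(ν.prod (volume.restrict (Ioc (0 : ℝ) 1))), z.2 ∈ Ioc (0 : ℝ) 1 :=
    Measure.quasiMeasurePreserving_snd.ae (ae_restrict_mem measurableSet_Ioc)
  refine .of_bound (C := 1) (Continuous.aestronglyMeasurable (by fun_prop)) ?_
  filter_upwards [hmem] with z hz
  rw [Function.uncurry_def, norm_mul]
  exact mul_le_one₀ (by rw [norm_eq_abs, abs_le]; constructor <;> linarith [hz.1, hz.2])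
    (norm_nonneg _) (abs_cos_le_one _)

theorem integral_fejer_eq (T b : ℝ) :
    ∫ x, fejer (T * x + b) ∂ν = 2 * ∫ t in (0 : ℝ)..1,
      (1 - t) * (Complex.exp (↑(t * b) * Complex.I) * charFun ν (t * T)).re := by
  simp_rw [fejer_eq_integral, integral_const_mul, intervalIntegral.integral_of_le zero_le_one,
    integral_integral_swap (integrable_uncurry_fejer_integrand T b), integral_const_mul,
    ← integral_cos_eq_re_charFun, mul_add, mul_assoc]

theorem continuous_re_exp_mul_charFun (T b : ℝ) : Continuous fun t : ℝ =>
    (1 - t) * (Complex.exp (↑(t * b) * Complex.I) * charFun ν (t * T)).re := by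
  have : Continuous (charFun ν) := continuous_charFun
  fun_prop

theorem one_sub_mul_abs_re_exp_mul_le {t : ℝ} (ht : t ∈ Icc (0 : ℝ) 1) (b : ℝ) (z : ℂ) :
    |(1 - t) * (Complex.exp (b * Complex.I) * z).re| ≤ ‖z‖ := by
  have hre : |(Complex.exp (b * Complex.I) * z).re| ≤ ‖z‖ := by
    simpa [Complex.norm_exp_ofReal_mul_I] using
      Complex.abs_re_le_norm (Complex.exp (b * Complex.I) * z)
  rw [abs_mul, abs_of_nonneg (sub_nonneg.2 ht.2)]
  exact (mul_le_of_le_one_left (abs_nonneg _) (by linarith [ht.1])).trans hre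

theorem integral_fejer_le_integral_norm_charFun (T b : ℝ) :
    ∫ x, fejer (T * x + b) ∂ν ≤ 2 * ∫ t in (0 : ℝ)..1, ‖charFun ν (t * T)‖ := by
  have : Continuous (charFun ν) := continuous_charFun
  rw [integral_fejer_eq]
  gcongr
  exact intervalIntegral.integral_mono_on zero_le_one
    ((continuous_re_exp_mul_charFun T b).intervalIntegrable _ _)
    (Continuous.intervalIntegrable (by fun_prop) _ _)
    fun t ht => (le_abs_self _).trans (one_sub_mul_abs_re_exp_mul_le ht _ _)

theorem integral_fejer_le_add_integral_norm_charFun_sub (T b : ℝ) :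
    ∫ x, fejer (T * x + b) ∂ν' ≤ ∫ x, fejer (T * x + b) ∂ν
      + 2 * ∫ t in (0 : ℝ)..1, ‖charFun ν (t * T) - charFun ν' (t * T)‖ := by
  have : Continuous (charFun ν) := continuous_charFun
  have : Continuous (charFun ν') := continuous_charFun
  have hν := (continuous_re_exp_mul_charFun (ν := ν) T b).intervalIntegrable (μ := volume) 0 1
  have hν' := (continuous_re_exp_mul_charFun (ν := ν') T b).intervalIntegrable (μ := volume) 0 1
  rw [integral_fejer_eq, integral_fejer_eq, ← sub_le_iff_le_add', ← mul_sub,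
    ← intervalIntegral.integral_sub hν' hν]
  gcongr
  refine intervalIntegral.integral_mono_on zero_le_one (hν'.sub hν)
    (Continuous.intervalIntegrable (by fun_prop) _ _) fun t ht => ?_
  rw [← mul_sub, ← Complex.sub_re, ← mul_sub, norm_sub_rev]
  exact (le_abs_self _).trans (one_sub_mul_abs_re_exp_mul_le ht _ _)

end Smoothing

section NearGaussian

theorem le_mul_mul_exp_of_le_of_le {d a x y : ℝ} (hd : 0 ≤ d) (ha : 0 ≤ a) (hx : 0 ≤ x)
    (hcube : d ≤ (a * x) ^ 3) (hexp : d ≤ 2 * exp (-y)) :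
    d ≤ 2 * a * x * exp (-(2 * y / 3)) := by
  refine le_of_pow_le_pow_left₀ three_ne_zero (by positivity) ?_
  calc d ^ 3 = d * d ^ 2 := by ring
    _ ≤ (a * x) ^ 3 * (2 * exp (-y)) ^ 2 := by gcongr
    _ = 4 * (a * x) ^ 3 * exp (-(2 * y / 3)) ^ 3 := by
        rw [mul_pow 2, ← exp_nat_mul, ← exp_nat_mul]
        push_cast
        ring_nf
    _ ≤ 8 * (a * x) ^ 3 * exp (-(2 * y / 3)) ^ 3 := by
        gcongr
        norm_num
    _ = (2 * a * x * exp (-(2 * y / 3))) ^ 3 := by ring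

theorem integral_mul_exp_neg_sq_le {r : ℝ} (hr : 0 < r) :
    ∫ t in (0 : ℝ)..1, r * t * exp (-((r * t) ^ 2 / 6)) ≤ 3 / r := by
  have hderiv : ∀ t ∈ uIcc (0 : ℝ) 1, HasDerivAt (fun t => -(3 / r) * exp (-((r * t) ^ 2 / 6)))
      (r * t * exp (-((r * t) ^ 2 / 6))) t := by
    intro t _
    have hmul : HasDerivAt (fun t : ℝ => r * t) r t := by simpa using (hasDerivAt_id t).const_mul r
    have hsq : HasDerivAt (fun t : ℝ => -((r * t) ^ 2 / 6)) (-(r ^ 2 * t / 3)) t :=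
      ((hmul.pow 2).div_const 6).neg.congr_deriv (by norm_num; ring)
    refine (hsq.exp.const_mul (-(3 / r))).congr_deriv ?_
    field_simp
  rw [intervalIntegral.integral_eq_sub_of_hasDerivAt hderiv
    (Continuous.intervalIntegrable (by fun_prop) _ _)]
  have : 0 ≤ 3 / r * exp (-((r * 1) ^ 2 / 6)) := by positivity
  simp only [mul_zero, zero_pow two_ne_zero, zero_div, neg_zero, exp_zero]
  linarith

theorem integral_exp_neg_sq_le {r : ℝ} (hr : 0 < r) :
    ∫ t in (0 : ℝ)..1, exp (-((r * t) ^ 2 / 4)) ≤ 2 / r := by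
  have hsqrt : √(π / (r ^ 2 / 4)) ≤ 4 / r := by
    rw [sqrt_le_left (by positivity), div_pow, div_le_div_iff₀ (by positivity) (by positivity)]
    nlinarith [pi_lt_four, sq_pos_of_pos hr]
  calc ∫ t in (0 : ℝ)..1, exp (-((r * t) ^ 2 / 4))
      = ∫ t in Ioc (0 : ℝ) 1, exp (-(r ^ 2 / 4) * t ^ 2) := by
        rw [intervalIntegral.integral_of_le zero_le_one]
        ring_nf
    _ ≤ ∫ t in Ioi (0 : ℝ), exp (-(r ^ 2 / 4) * t ^ 2) :=
        setIntegral_mono_set (integrable_exp_neg_mul_sq (by positivity)).integrableOn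
          (ae_of_all _ fun t => (exp_pos _).le) Ioc_subset_Ioi_self.eventuallyLE
    _ ≤ 2 / r := by
        rw [integral_gaussian_Ioi]
        linarith [show 2 * (2 / r) = 4 / r by ring]

theorem one_div_six_mul_le_gaussianPDFReal {s x : ℝ} (hs : 0 < s) (hx : |x| ≤ s) :
    1 / (6 * s) ≤ gaussianPDFReal 0 (s ^ 2).toNNReal x := by
  have hsqrt : √(2 * π * s ^ 2) ≤ 3 * s := by
    rw [sqrt_le_left (by positivity)]
    nlinarith [pi_lt_four, sq_pos_of_pos hs]
  have hexp : 1 / 2 ≤ exp (-x ^ 2 / (2 * s ^ 2)) := by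
    have : x ^ 2 / (2 * s ^ 2) ≤ 1 / 2 := by
      rw [div_le_div_iff₀ (by positivity) two_pos]
      nlinarith [sq_le_sq' (abs_le.1 hx).1 (abs_le.1 hx).2]
    linarith [add_one_le_exp (-x ^ 2 / (2 * s ^ 2)), neg_div (2 * s ^ 2) (x ^ 2)]
  simp only [gaussianPDFReal_def, sub_zero, coe_toNNReal _ (sq_nonneg s)]
  calc 1 / (6 * s) = (3 * s)⁻¹ * (1 / 2) := by
        field_simp
        norm_num
    _ ≤ _ := by gcongr

theorem le_integral_fejer_gaussianReal {s T b : ℝ} (hs : 0 < s) (hT : 0 < T)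
    (hb : |b| + 2 ≤ s * T) :
    1 / (4 * (s * T)) ≤ ∫ x, fejer (T * x + b) ∂gaussianReal 0 (s ^ 2).toNNReal := by
  set v : ℝ≥0 := (s ^ 2).toNNReal
  have hv : v ≠ 0 := (toNNReal_pos.2 (by positivity)).ne'
  have hint : Integrable fun x => gaussianPDFReal 0 v x * fejer (T * x + b) :=
    (integrable_gaussianPDFReal 0 v).mul_bdd (c := 1) (by fun_prop) (ae_of_all _ fun x => by
      rw [norm_of_nonneg (fejer_nonneg _)]
      exact fejer_le_one _)
  have hball : ∀ x ∈ Metric.closedBall (-(b / T)) (2 / T),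
      1 / (6 * s) * (2 / 5) ≤ gaussianPDFReal 0 v x * fejer (T * x + b) := by
    intro x hx
    have hTx : |T * x + b| ≤ 2 := by
      rw [Metric.mem_closedBall, dist_eq, le_div_iff₀ hT] at hx
      rwa [show T * x + b = (x - -(b / T)) * T by field_simp; ring, abs_mul, abs_of_pos hT]
    have hxs : |x| ≤ s := by
      have hle : |T * x| ≤ s * T := by linarith [abs_sub_abs_le_abs_add (T * x) b]
      rw [abs_mul, abs_of_pos hT, mul_comm] at hle
      exact le_of_mul_le_mul_right hle hT
    exact mul_le_mul (one_div_six_mul_le_gaussianPDFReal hs hxs)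
      (two_fifths_le_fejer (hTx.trans two_le_pi)) (by norm_num) (gaussianPDFReal_nonneg _ _ _)
  calc 1 / (4 * (s * T))
      ≤ 1 / (6 * s) * (2 / 5) * volume.real (Metric.closedBall (-(b / T)) (2 / T)) := by
        rw [Real.volume_real_closedBall (by positivity)]
        field_simp
        norm_num
    _ ≤ ∫ x in Metric.closedBall (-(b / T)) (2 / T), gaussianPDFReal 0 v x * fejer (T * x + b) :=
        setIntegral_ge_of_const_le_real measurableSet_closedBall
          measure_closedBall_lt_top.ne hball hint.integrableOn
    _ ≤ ∫ x, gaussianPDFReal 0 v x * fejer (T * x + b) :=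
        setIntegral_le_integral hint <| ae_of_all _ fun x =>
          mul_nonneg (gaussianPDFReal_nonneg _ _ _) (fejer_nonneg _)
    _ = _ := by simp_rw [integral_gaussianReal_eq_integral_smul hv, smul_eq_mul]

theorem continuous_gFun (α : ℝ) : Continuous (gFun α) := by
  unfold gFun
  fun_prop

theorem gFun_nonneg (α x : ℝ) : 0 ≤ gFun α x := (exp_pos _).le

theorem gFun_le_exp_neg_mul_abs {α m : ℝ} (h₀ : m ≤ α) (h₁ : m ≤ 1 - α) (x : ℝ) :
    gFun α x ≤ exp (-(m * |x|)) := by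
  rw [gFun, exp_le_exp]
  rcases le_total 0 x with hx | hx
  · rw [abs_of_nonneg hx]
    exact (min_le_right _ _).trans (by nlinarith)
  · rw [abs_of_nonpos hx]
    exact (min_le_left _ _).trans (by nlinarith)

theorem exists_exp_le_gFun_closedBall {α H : ℝ} (hα : α ∈ Ioo (0 : ℝ) 1) (hH : 0 ≤ H) :
    ∃ c, |c| = H ∧
      ∀ x ∈ Metric.closedBall c H, exp (-(4 * (H * ((1 - α) * α)))) ≤ gFun α x := by
  obtain ⟨h₀, h₁⟩ := hα
  -- The decay rate of `gFun α` is `α` on the left and `1 - α` on the right; take the slower side.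
  rcases le_total α (1 / 2) with hle | hle
  · refine ⟨-H, by rw [abs_neg, abs_of_nonneg hH], fun x hx => ?_⟩
    have hαH : α * H ≤ 2 * (H * ((1 - α) * α)) := by nlinarith [mul_nonneg h₀.le hH]
    rw [Metric.mem_closedBall, dist_eq, abs_le] at hx
    rw [gFun, exp_le_exp, le_min_iff]
    constructor <;> nlinarith
  · refine ⟨H, abs_of_nonneg hH, fun x hx => ?_⟩
    have hαH : (1 - α) * H ≤ 2 * (H * ((1 - α) * α)) := by
      nlinarith [mul_nonneg (sub_nonneg.2 h₁.le) hH]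
    rw [Metric.mem_closedBall, dist_eq, abs_le] at hx
    rw [gFun, exp_le_exp, le_min_iff]
    constructor <;> nlinarith

theorem fejer_sub_le_indicator_closedBall {c H M : ℝ} (hH : 0 < H) (hM : 0 < M) (x : ℝ) :
    fejer (M / H * x + -(M * c / H))
        - 18 / M ^ 2 * (fejer (1 / H * x + -(c / H)) + fejer (1 / H * x + (-(c / H) + π)))
      ≤ indicator (Metric.closedBall c H) 1 x := by
  have hmem : {y : ℝ | |y| ≤ 1}.indicator (1 : ℝ → ℝ) ((x - c) / H)
      = indicator (Metric.closedBall c H) 1 x := by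
    simp only [indicator, mem_ofPred_eq, Metric.mem_closedBall, dist_eq, abs_div, abs_of_pos hH,
      div_le_one hH, Pi.one_apply]
  rw [← hmem]
  convert! fejer_sub_le_indicator hM ((x - c) / H) using 3 <;> ring_nf

/-- The characteristic function of `ν` is bounded by a Gaussian on the window `[0, 1 / (16 C)]` and
agrees with that of the centred Gaussian law of standard deviation `s` up to a cubic error. A sum
of independent centred variables has this property as soon as its variance is `s ^ 2` and its third
absolute moments add up to at most `C s ^ 2`. -/
structure IsNearGaussian (ν : Measure ℝ) (s C : ℝ) : Prop where
  norm_charFun_le : ∀ u ∈ Icc 0 (1 / (16 * C)), ‖charFun ν u‖ ≤ exp (-((s * u) ^ 2 / 4))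
  norm_charFun_sub_le : ∀ u, 0 ≤ u →
    ‖charFun ν u - exp (-((s * u) ^ 2 / 2))‖ ≤ 5 * C * s ^ 2 * u ^ 3

variable {ν : Measure ℝ} {s C : ℝ}

-- The cubic bound is good for small `u` and the Gaussian one for large `u`: interpolate.
theorem IsNearGaussian.norm_charFun_gaussianReal_sub_le {u : ℝ} (h : IsNearGaussian ν s C)
    (hs : 0 < s) (hCs : 5 * 96 ^ 3 * C ≤ s) (hu : u ∈ Icc 0 (1 / (16 * C))) :
    ‖charFun (gaussianReal 0 (s ^ 2).toNNReal) u - charFun ν u‖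
      ≤ 1 / 48 * (s * u * exp (-((s * u) ^ 2 / 6))) := by
  have hγ : charFun (gaussianReal 0 (s ^ 2).toNNReal) u = exp (-((s * u) ^ 2 / 2)) := by
    rw [charFun_gaussianReal, coe_toNNReal _ (sq_nonneg s)]
    push_cast
    ring_nf
  rw [hγ, norm_sub_rev]
  have hcube : ‖charFun ν u - exp (-((s * u) ^ 2 / 2))‖ ≤ (1 / 96 * (s * u)) ^ 3 := by
    refine (h.norm_charFun_sub_le u hu.1).trans ?_
    have : 0 ≤ s ^ 2 * u ^ 3 := by have := hu.1; positivity
    nlinarith [mul_le_mul_of_nonneg_right hCs this]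
  have hexp : ‖charFun ν u - exp (-((s * u) ^ 2 / 2))‖ ≤ 2 * exp (-((s * u) ^ 2 / 4)) := by
    have hle : exp (-((s * u) ^ 2 / 2)) ≤ exp (-((s * u) ^ 2 / 4)) :=
      exp_le_exp.2 (by linarith [sq_nonneg (s * u)])
    have hn := norm_sub_le (charFun ν u) (exp (-((s * u) ^ 2 / 2)) : ℝ)
    rw [Complex.norm_real, norm_of_nonneg (exp_pos _).le] at hn
    linarith [h.norm_charFun_le u hu]
  refine (le_mul_mul_exp_of_le_of_le (norm_nonneg _) (by norm_num) (mul_nonneg hs.le hu.1)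
    hcube hexp).trans_eq ?_
  ring_nf

variable [IsProbabilityMeasure ν]

theorem integrable_gFun {α : ℝ} (hα : α ∈ Ioo (0 : ℝ) 1) : Integrable (gFun α) ν :=
  .of_bound (C := 1) (continuous_gFun α).aestronglyMeasurable <| ae_of_all _ fun x => by
    rw [norm_of_nonneg (gFun_nonneg _ _)]
    simpa using gFun_le_exp_neg_mul_abs hα.1.le (sub_nonneg.2 hα.2.le) x

theorem integral_fejer_sub_le_measureReal_closedBall {c H M : ℝ} (hH : 0 < H) (hM : 0 < M) :
    ∫ x, fejer (M / H * x + -(M * c / H)) ∂ν - 18 / M ^ 2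
        * (∫ x, fejer (1 / H * x + -(c / H)) ∂ν + ∫ x, fejer (1 / H * x + (-(c / H) + π)) ∂ν)
      ≤ ν.real (Metric.closedBall c H) := by
  have hint₀ := integrable_fejer (ν := ν) (M / H) (-(M * c / H))
  have hint₁ := integrable_fejer (ν := ν) (1 / H) (-(c / H))
  have hint₂ := integrable_fejer (ν := ν) (1 / H) (-(c / H) + π)
  have hint₁₂ : Integrable (fun x => 18 / M ^ 2
      * (fejer (1 / H * x + -(c / H)) + fejer (1 / H * x + (-(c / H) + π)))) ν :=
    (hint₁.add hint₂).const_mul _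
  rw [← integral_add hint₁ hint₂, ← integral_const_mul, ← integral_sub hint₀ hint₁₂,
    ← integral_indicator_one measurableSet_closedBall]
  exact integral_mono (hint₀.sub hint₁₂)
    ((integrable_const 1).indicator measurableSet_closedBall)
    (fejer_sub_le_indicator_closedBall hH hM)

namespace IsNearGaussian

theorem integral_fejer_le {T : ℝ} (h : IsNearGaussian ν s C) (hs : 0 < s) (hT : 0 < T)
    (hTC : T ≤ 1 / (16 * C)) (b : ℝ) : ∫ x, fejer (T * x + b) ∂ν ≤ 4 / (s * T) := by
  have : Continuous (charFun ν) := continuous_charFun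
  calc ∫ x, fejer (T * x + b) ∂ν ≤ 2 * ∫ t in (0 : ℝ)..1, ‖charFun ν (t * T)‖ :=
        integral_fejer_le_integral_norm_charFun T b
    _ ≤ 2 * ∫ t in (0 : ℝ)..1, exp (-((s * T * t) ^ 2 / 4)) := by
        gcongr
        refine intervalIntegral.integral_mono_on zero_le_one
          (Continuous.intervalIntegrable (by fun_prop) _ _)
          (Continuous.intervalIntegrable (by fun_prop) _ _) fun t ht => ?_
        rw [show s * T * t = s * (t * T) by ring]
        exact h.norm_charFun_le _ ⟨mul_nonneg ht.1 hT.le,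
          (mul_le_of_le_one_left hT.le ht.2).trans hTC⟩
    _ ≤ 2 * (2 / (s * T)) := by
        gcongr
        exact integral_exp_neg_sq_le (by positivity)
    _ = 4 / (s * T) := by ring

theorem le_integral_fejer {T b : ℝ} (h : IsNearGaussian ν s C) (hs : 0 < s)
    (hCs : 5 * 96 ^ 3 * C ≤ s) (hT : 0 < T) (hTC : T ≤ 1 / (16 * C)) (hb : |b| + 2 ≤ s * T) :
    1 / (8 * (s * T)) ≤ ∫ x, fejer (T * x + b) ∂ν := by
  set γ := gaussianReal 0 (s ^ 2).toNNReal
  have : Continuous (charFun ν) := continuous_charFun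
  have : Continuous (charFun γ) := continuous_charFun
  have herr : ∫ t in (0 : ℝ)..1, ‖charFun ν (t * T) - charFun γ (t * T)‖ ≤ 1 / (16 * (s * T)) :=
    calc ∫ t in (0 : ℝ)..1, ‖charFun ν (t * T) - charFun γ (t * T)‖
        ≤ ∫ t in (0 : ℝ)..1, 1 / 48 * (s * T * t * exp (-((s * T * t) ^ 2 / 6))) := by
          refine intervalIntegral.integral_mono_on zero_le_one
            (Continuous.intervalIntegrable (by fun_prop) _ _)
            (Continuous.intervalIntegrable (by fun_prop) _ _) fun t ht => ?_
          rw [show s * T * t = s * (t * T) by ring, norm_sub_rev]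
          exact h.norm_charFun_gaussianReal_sub_le hs hCs ⟨mul_nonneg ht.1 hT.le,
            (mul_le_of_le_one_left hT.le ht.2).trans hTC⟩
      _ ≤ 1 / 48 * (3 / (s * T)) := by
          rw [intervalIntegral.integral_const_mul]
          gcongr
          exact integral_mul_exp_neg_sq_le (by positivity)
      _ = 1 / (16 * (s * T)) := by
          field_simp
          norm_num
  have hγ := le_integral_fejer_gaussianReal hs hT hb
  have hcmp := integral_fejer_le_add_integral_norm_charFun_sub (ν := ν) (ν' := γ) T b
  have hsplit : 1 / (4 * (s * T)) = 1 / (8 * (s * T)) + 2 * (1 / (16 * (s * T))) := by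
    field_simp
    norm_num
  linarith

theorem integral_gFun_le {α : ℝ} (h : IsNearGaussian ν s C) (hs : 0 < s) (hC : 1 ≤ C)
    (hα : α ∈ Ioo (0 : ℝ) 1) : ∫ x, gFun α x ∂ν ≤ 512 * C / (s * (1 - α) * α) := by
  obtain ⟨h₀, h₁⟩ := hα
  have : 0 < 1 - α := sub_pos.2 h₁
  have hC' : 1 / (16 * C) ≤ 1 := by
    rw [div_le_one (by positivity)]
    linarith
  set T := 1 / (16 * C) * ((1 - α) * α) with hTdef
  have hT : 0 < T := by positivity
  have hTα : T ≤ (1 - α) * α := mul_le_of_le_one_left (by positivity) hC'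
  have hTC : T ≤ 1 / (16 * C) := mul_le_of_le_one_right (by positivity) (by nlinarith)
  have hpt : ∀ x, gFun α x ≤ 4 * (fejer (T * x + 0) + fejer (T * x + π)) := by
    intro x
    refine (gFun_le_exp_neg_mul_abs (m := T) (by nlinarith) (by nlinarith) x).trans ?_
    rw [add_zero, ← abs_of_pos hT, ← abs_mul, abs_of_pos hT]
    exact exp_neg_abs_le_fejer_add_fejer (T * x)
  calc ∫ x, gFun α x ∂ν ≤ ∫ x, 4 * (fejer (T * x + 0) + fejer (T * x + π)) ∂ν :=
        integral_mono (integrable_gFun ⟨h₀, h₁⟩)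
          (((integrable_fejer T 0).add (integrable_fejer T π)).const_mul 4) hpt
    _ = 4 * (∫ x, fejer (T * x + 0) ∂ν + ∫ x, fejer (T * x + π) ∂ν) := by
        rw [integral_const_mul, integral_add (integrable_fejer T 0) (integrable_fejer T π)]
    _ ≤ 4 * (4 / (s * T) + 4 / (s * T)) := by
        gcongr <;> exact h.integral_fejer_le hs hT hTC _
    _ = 512 * C / (s * (1 - α) * α) := by
        rw [hTdef]
        field_simp
        norm_num

theorem le_measureReal_closedBall {c H : ℝ} (h : IsNearGaussian ν s C) (hC : 0 < C)
    (hCs : 5 * 96 ^ 3 * C ≤ s) (hH : 36864 * C ≤ H) (hHs : 2 * H ≤ s) (hc : |c| ≤ H) :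
    H / (36864 * s) ≤ ν.real (Metric.closedBall c H) := by
  have hs : 0 < s := by linarith
  have hH0 : 0 < H := by linarith
  have hTC : 2304 / H ≤ 1 / (16 * C) := by
    rw [div_le_div_iff₀ hH0 (by positivity)]
    linarith
  have hTC' : 1 / H ≤ 1 / (16 * C) := le_trans (by gcongr; norm_num) hTC
  have hb : |-(2304 * c / H)| + 2 ≤ s * (2304 / H) := by
    rw [abs_neg, abs_div, abs_mul, abs_of_pos hH0, abs_of_pos (by norm_num : (0 : ℝ) < 2304),
      ← le_sub_iff_add_le, div_le_iff₀ hH0, sub_mul, mul_assoc, div_mul_cancel₀ _ hH0.ne']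
    linarith
  -- With `M = 2304 = 16 * 144` the error `144 * H / (M ^ 2 * s)` is half of `H / (8 * M * s)`.
  calc H / (36864 * s) = 1 / (8 * (s * (2304 / H)))
        - 18 / 2304 ^ 2 * (4 / (s * (1 / H)) + 4 / (s * (1 / H))) := by
        field_simp
        norm_num
    _ ≤ ∫ x, fejer (2304 / H * x + -(2304 * c / H)) ∂ν - 18 / 2304 ^ 2
          * (∫ x, fejer (1 / H * x + -(c / H)) ∂ν
            + ∫ x, fejer (1 / H * x + (-(c / H) + π)) ∂ν) := by
        gcongr
        · exact h.le_integral_fejer hs hCs (by positivity) hTC hb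
        all_goals exact h.integral_fejer_le hs (by positivity) hTC' _
    _ ≤ ν.real (Metric.closedBall c H) :=
        integral_fejer_sub_le_measureReal_closedBall hH0 (by norm_num)

theorem le_integral_gFun {α : ℝ} (h : IsNearGaussian ν s C) (hC : 0 < C)
    (hα : α ∈ Ioo (0 : ℝ) 1) (hCs : 5 * 96 ^ 3 * C ≤ s * (1 - α) * α) :
    C * exp (-(4 * (36864 * C))) / (s * (1 - α) * α) ≤ ∫ x, gFun α x ∂ν := by
  have h₀ := hα.1
  have h₁ : 0 < 1 - α := sub_pos.2 hα.2
  rw [mul_assoc s] at hCs ⊢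
  set m := (1 - α) * α with hm
  have hm0 : 0 < m := by positivity
  have hm1 : m ≤ 1 := by nlinarith
  have hs : 0 < s := pos_of_mul_pos_left (by linarith) hm0.le
  set H := 36864 * C / m with hHdef
  have hHm : H * m = 36864 * C := div_mul_cancel₀ _ hm0.ne'
  have hH : 36864 * C ≤ H := le_div_self (by positivity) hm0 hm1
  have hHs : 2 * H ≤ s := le_of_mul_le_mul_right (by linarith) hm0
  obtain ⟨c, hc, hg⟩ := exists_exp_le_gFun_closedBall hα (H := H) (by positivity)
  rw [← hm, hHm] at hg
  calc C * exp (-(4 * (36864 * C))) / (s * m)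
      = exp (-(4 * (36864 * C))) * (H / (36864 * s)) := by
        rw [hHdef]
        field_simp
    _ ≤ exp (-(4 * (36864 * C))) * ν.real (Metric.closedBall c H) := by
        gcongr
        exact h.le_measureReal_closedBall hC (hCs.trans (mul_le_of_le_one_right hs.le hm1))
          hH hHs hc.le
    _ ≤ ∫ x in Metric.closedBall c H, gFun α x ∂ν :=
        setIntegral_ge_of_const_le_real measurableSet_closedBall (measure_ne_top _ _) hg
          (integrable_gFun hα).integrableOn
    _ ≤ ∫ x, gFun α x ∂ν :=
        setIntegral_le_integral (integrable_gFun hα) (ae_of_all _ (gFun_nonneg α))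

end IsNearGaussian

end NearGaussian

section ThirdMoment

theorem norm_exp_mul_I_sub_le (x : ℝ) :
    ‖Complex.exp (x * Complex.I) - (1 + x * Complex.I - x ^ 2 / 2)‖ ≤ 4 * |x| ^ 3 := by
  have hn : ‖(x : ℂ) * Complex.I‖ = |x| := by simp
  rcases le_total |x| 1 with h | h
  · have htaylor := Complex.exp_bound (x := x * Complex.I) (by rwa [hn]) (n := 3) (by norm_num)
    have hsum : ∑ m ∈ Finset.range 3, ((x : ℂ) * Complex.I) ^ m / m.factorial
        = 1 + x * Complex.I - x ^ 2 / 2 := by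
      simp [Finset.sum_range_succ, mul_pow]
      ring
    rw [hsum, hn] at htaylor
    refine htaylor.trans ?_
    norm_num [Nat.factorial]
    nlinarith [pow_nonneg (abs_nonneg x) 3]
  · have hpoly : ‖(1 : ℂ) + x * Complex.I - x ^ 2 / 2‖ ≤ 1 + |x| + |x| ^ 2 / 2 := by
      refine (norm_sub_le _ _).trans (add_le_add ((norm_add_le _ _).trans_eq ?_) (le_of_eq ?_))
      · rw [norm_one, hn]
      · simp
    have hsq : |x| ≤ |x| ^ 2 := le_self_pow₀ h two_ne_zero
    have hcube : |x| ^ 2 ≤ |x| ^ 3 := pow_le_pow_right₀ h (by norm_num)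
    refine (norm_sub_le _ _).trans ?_
    rw [Complex.norm_exp_ofReal_mul_I]
    linarith

theorem abs_one_sub_sub_exp_neg_le {w β : ℝ} (hw : 0 ≤ w) (hβ : 0 ≤ β)
    (h : ∀ l > 0, w ≤ l ^ 2 + β / l) :
    |1 - w / 2 - exp (-(w / 2))| ≤ β := by
  have hexp := add_one_le_exp (-(w / 2))
  rw [abs_of_nonpos (by linarith)]
  rcases le_or_gt w 2 with hw2 | hw2
  · have hsq : w ^ 2 ≤ 4 * β := by
      rcases hw.eq_or_lt with rfl | hw'
      · linarith
      · have hl := h (w / 2) (half_pos hw')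
        rw [← sub_le_iff_le_add', le_div_iff₀ (half_pos hw')] at hl
        nlinarith [sq_nonneg w]
    have hquad := (abs_le.1 <| abs_exp_sub_one_sub_id_le (x := -(w / 2)) <| by
      rw [abs_neg, abs_of_nonneg (by linarith)]
      linarith).2
    nlinarith
  · have : exp (-(w / 2)) ≤ 1 := exp_le_one_iff.2 (by linarith)
    linarith [h 1 one_pos]

variable {Ω : Type*} [MeasurableSpace Ω] {P : Measure Ω} {X : Ω → ℝ}

theorem charFun_map_eq_integral (hX : AEMeasurable X P) (u : ℝ) :
    charFun (P.map X) u = ∫ ω, Complex.exp ((u * X ω : ℝ) * Complex.I) ∂P := by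
  rw [charFun_apply_real, integral_map hX (by fun_prop)]
  push_cast
  rfl

variable [IsProbabilityMeasure P]

theorem integral_sq_le_of_memLp_three (hX : MemLp X 3 P) {l : ℝ} (hl : 0 < l) :
    ∫ ω, X ω ^ 2 ∂P ≤ l ^ 2 + (∫ ω, |X ω| ^ 3 ∂P) / l := by
  have hcube : Integrable (fun ω => |X ω| ^ 3) P := hX.integrable_norm_pow (by norm_num)
  have hpt : ∀ ω, X ω ^ 2 ≤ l ^ 2 + |X ω| ^ 3 / l := by
    intro ω
    rw [← sq_abs]
    rcases le_total |X ω| l with hle | hle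
    · exact le_add_of_le_of_nonneg (by gcongr) (by positivity)
    · refine le_add_of_nonneg_of_le (sq_nonneg l) ?_
      rw [le_div_iff₀ hl, pow_succ _ 2]
      gcongr
  calc ∫ ω, X ω ^ 2 ∂P ≤ ∫ ω, (l ^ 2 + |X ω| ^ 3 / l) ∂P :=
        integral_mono (hX.mono_exponent (by norm_num)).integrable_sq
          ((integrable_const _).add (hcube.div_const l)) hpt
    _ = l ^ 2 + (∫ ω, |X ω| ^ 3 ∂P) / l := by
        rw [integral_add (integrable_const _) (hcube.div_const l), integral_div, integral_const,
          probReal_univ, one_smul]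

theorem norm_integral_exp_mul_I_sub_le (hX : MemLp X 3 P) (h₀ : ∫ ω, X ω ∂P = 0) :
    ‖∫ ω, Complex.exp (X ω * Complex.I) ∂P - (1 - (∫ ω, X ω ^ 2 ∂P) / 2 : ℝ)‖
      ≤ 4 * ∫ ω, |X ω| ^ 3 ∂P := by
  have hm := hX.aestronglyMeasurable.aemeasurable
  have hexp : Integrable (fun ω => Complex.exp (X ω * Complex.I)) P :=
    .of_bound (C := 1) (by fun_prop) (ae_of_all _ fun ω => (Complex.norm_exp_ofReal_mul_I _).le)
  have hlin : Integrable (fun ω => (X ω : ℂ) * Complex.I) P :=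
    (hX.integrable (by norm_num)).ofReal.mul_const _
  have hquad : Integrable (fun ω => (X ω : ℂ) ^ 2 / 2) P := by
    simpa using (hX.mono_exponent (by norm_num) : MemLp X 2 P).integrable_sq.ofReal
      (𝕜 := ℂ) |>.div_const 2
  have hpoly : Integrable (fun ω => 1 + (X ω : ℂ) * Complex.I) P := (integrable_const 1).add hlin
  have htwo : Integrable (fun ω => 1 + (X ω : ℂ) * Complex.I - (X ω : ℂ) ^ 2 / 2) P :=
    hpoly.sub hquad
  have htaylor : ∫ ω, (1 + X ω * Complex.I - X ω ^ 2 / 2 : ℂ) ∂P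
      = (1 - (∫ ω, X ω ^ 2 ∂P) / 2 : ℝ) := by
    rw [integral_sub hpoly hquad, integral_add (integrable_const _) hlin, integral_mul_const,
      integral_complex_ofReal, h₀, integral_div]
    simp [← integral_complex_ofReal]
  rw [← htaylor, ← integral_sub hexp htwo, ← integral_const_mul]
  exact norm_integral_le_of_norm_le ((hX.integrable_norm_pow (by norm_num)).const_mul 4)
    (ae_of_all _ fun ω => norm_exp_mul_I_sub_le (X ω))

theorem norm_integral_exp_mul_I_le (hX : MemLp X 3 P) (h₀ : ∫ ω, X ω ∂P = 0) :
    ‖∫ ω, Complex.exp (X ω * Complex.I) ∂P‖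
      ≤ exp (-((∫ ω, X ω ^ 2 ∂P) / 2) + 4 * ∫ ω, |X ω| ^ 3 ∂P) := by
  rcases le_total (∫ ω, X ω ^ 2 ∂P) 2 with hle | hle
  · have htri := norm_sub_norm_le (∫ ω, Complex.exp (X ω * Complex.I) ∂P)
      (1 - (∫ ω, X ω ^ 2 ∂P) / 2 : ℝ)
    rw [Complex.norm_real, norm_of_nonneg (by linarith)] at htri
    linarith [norm_integral_exp_mul_I_sub_le hX h₀,
      add_one_le_exp (-((∫ ω, X ω ^ 2 ∂P) / 2) + 4 * ∫ ω, |X ω| ^ 3 ∂P)]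
  · refine (norm_integral_le_of_norm_le_const (C := 1)
      (ae_of_all _ fun ω => (Complex.norm_exp_ofReal_mul_I _).le)).trans ?_
    rw [probReal_univ, one_mul, one_le_exp_iff]
    have : 0 ≤ ∫ ω, |X ω| ^ 3 ∂P := integral_nonneg fun ω => by positivity
    linarith [integral_sq_le_of_memLp_three hX one_pos]

theorem norm_integral_exp_mul_I_sub_exp_le (hX : MemLp X 3 P) (h₀ : ∫ ω, X ω ∂P = 0) :
    ‖∫ ω, Complex.exp (X ω * Complex.I) ∂P - exp (-((∫ ω, X ω ^ 2 ∂P) / 2))‖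
      ≤ 5 * ∫ ω, |X ω| ^ 3 ∂P := by
  have hexp : |1 - (∫ ω, X ω ^ 2 ∂P) / 2 - exp (-((∫ ω, X ω ^ 2 ∂P) / 2))| ≤ ∫ ω, |X ω| ^ 3 ∂P :=
    abs_one_sub_sub_exp_neg_le (integral_nonneg fun ω => sq_nonneg _)
      (integral_nonneg fun ω => by positivity) fun l hl => integral_sq_le_of_memLp_three hX hl
  calc ‖∫ ω, Complex.exp (X ω * Complex.I) ∂P - exp (-((∫ ω, X ω ^ 2 ∂P) / 2))‖
      ≤ ‖∫ ω, Complex.exp (X ω * Complex.I) ∂P - (1 - (∫ ω, X ω ^ 2 ∂P) / 2 : ℝ)‖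
        + ‖((1 - (∫ ω, X ω ^ 2 ∂P) / 2 : ℝ) : ℂ) - exp (-((∫ ω, X ω ^ 2 ∂P) / 2))‖ :=
        norm_sub_le_norm_sub_add_norm_sub _ _ _
    _ ≤ 4 * ∫ ω, |X ω| ^ 3 ∂P + ∫ ω, |X ω| ^ 3 ∂P := by
        refine add_le_add (norm_integral_exp_mul_I_sub_le hX h₀) ?_
        rwa [← Complex.ofReal_sub, Complex.norm_real]
    _ = 5 * ∫ ω, |X ω| ^ 3 ∂P := by ring

theorem norm_charFun_map_le (hX : MemLp X 3 P) (h₀ : ∫ ω, X ω ∂P = 0) {u : ℝ} (hu : 0 ≤ u) :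
    ‖charFun (P.map X) u‖
      ≤ exp (-(u ^ 2 * (∫ ω, X ω ^ 2 ∂P) / 2) + 4 * (u ^ 3 * ∫ ω, |X ω| ^ 3 ∂P)) := by
  have h := norm_integral_exp_mul_I_le (hX.const_mul u) (by rw [integral_const_mul, h₀, mul_zero])
  simp only [mul_pow, abs_mul, abs_of_nonneg hu, integral_const_mul] at h
  rwa [charFun_map_eq_integral hX.aestronglyMeasurable.aemeasurable]

theorem norm_charFun_map_sub_exp_le (hX : MemLp X 3 P) (h₀ : ∫ ω, X ω ∂P = 0) {u : ℝ}
    (hu : 0 ≤ u) :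
    ‖charFun (P.map X) u - exp (-(u ^ 2 * (∫ ω, X ω ^ 2 ∂P) / 2))‖
      ≤ 5 * (u ^ 3 * ∫ ω, |X ω| ^ 3 ∂P) := by
  have h := norm_integral_exp_mul_I_sub_exp_le (hX.const_mul u)
    (by rw [integral_const_mul, h₀, mul_zero])
  simp only [mul_pow, abs_mul, abs_of_nonneg hu, integral_const_mul] at h
  rwa [charFun_map_eq_integral hX.aestronglyMeasurable.aemeasurable]

theorem norm_prod_sub_prod_le {ι R : Type*} [NormedCommRing R] [NormOneClass R]
    (s : Finset ι) (a b : ι → R) (ha : ∀ i ∈ s, ‖a i‖ ≤ 1) (hb : ∀ i ∈ s, ‖b i‖ ≤ 1) :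
    ‖∏ i ∈ s, a i - ∏ i ∈ s, b i‖ ≤ ∑ i ∈ s, ‖a i - b i‖ := by
  classical
  induction s using Finset.induction_on with
  | empty => simp
  | insert i s hi ih =>
    rw [Finset.forall_mem_insert] at ha hb
    have hprod : ‖∏ j ∈ s, a j‖ ≤ 1 :=
      (Finset.norm_prod_le s a).trans (Finset.prod_le_one (fun _ _ => norm_nonneg _) ha.2)
    rw [Finset.prod_insert hi, Finset.prod_insert hi, Finset.sum_insert hi]
    calc ‖a i * ∏ j ∈ s, a j - b i * ∏ j ∈ s, b j‖
        = ‖(a i - b i) * ∏ j ∈ s, a j + b i * (∏ j ∈ s, a j - ∏ j ∈ s, b j)‖ := by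
          congr 1
          ring
      _ ≤ ‖a i - b i‖ * ‖∏ j ∈ s, a j‖ + ‖b i‖ * ‖∏ j ∈ s, a j - ∏ j ∈ s, b j‖ :=
          (norm_add_le _ _).trans (add_le_add (norm_mul_le _ _) (norm_mul_le _ _))
      _ ≤ ‖a i - b i‖ * 1 + 1 * ∑ j ∈ s, ‖a j - b j‖ := by
          gcongr
          exacts [hb.1, ih ha.2 hb.2]
      _ = ‖a i - b i‖ + ∑ j ∈ s, ‖a j - b j‖ := by rw [mul_one, one_mul]

section Sum

variable {ι : Type*} [Fintype ι] {X : ι → Ω → ℝ} {s C u : ℝ}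

theorem norm_charFun_map_sum_le (hX : ∀ i, MemLp (X i) 3 P) (h₀ : ∀ i, ∫ ω, X i ω ∂P = 0)
    (hind : iIndepFun X P) (hu : 0 ≤ u) :
    ‖charFun (P.map fun ω => ∑ i, X i ω) u‖
      ≤ exp (-(u ^ 2 * (∑ i, ∫ ω, X i ω ^ 2 ∂P) / 2)
        + 4 * (u ^ 3 * ∑ i, ∫ ω, |X i ω| ^ 3 ∂P)) :=
  calc ‖charFun (P.map fun ω => ∑ i, X i ω) u‖ = ∏ i, ‖charFun (P.map (X i)) u‖ := by
        rw [hind.charFun_map_fun_sum_eq_prod fun i => (hX i).aestronglyMeasurable.aemeasurable,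
          Finset.prod_apply, norm_prod]
    _ ≤ ∏ i, exp (-(u ^ 2 * (∫ ω, X i ω ^ 2 ∂P) / 2) + 4 * (u ^ 3 * ∫ ω, |X i ω| ^ 3 ∂P)) :=
        Finset.prod_le_prod (fun _ _ => norm_nonneg _)
          fun i _ => norm_charFun_map_le (hX i) (h₀ i) hu
    _ = _ := by
        rw [← exp_sum, Finset.sum_add_distrib, Finset.sum_neg_distrib, ← Finset.sum_div,
          ← Finset.mul_sum, ← Finset.mul_sum, ← Finset.mul_sum]

theorem norm_charFun_map_sum_sub_exp_le (hX : ∀ i, MemLp (X i) 3 P)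
    (h₀ : ∀ i, ∫ ω, X i ω ∂P = 0) (hind : iIndepFun X P) (hu : 0 ≤ u) :
    ‖charFun (P.map fun ω => ∑ i, X i ω) u - exp (-(u ^ 2 * (∑ i, ∫ ω, X i ω ^ 2 ∂P) / 2))‖
      ≤ 5 * (u ^ 3 * ∑ i, ∫ ω, |X i ω| ^ 3 ∂P) := by
  have hm i := (hX i).aestronglyMeasurable.aemeasurable
  have hgauss : exp (-(u ^ 2 * (∑ i, ∫ ω, X i ω ^ 2 ∂P) / 2))
      = ∏ i, exp (-(u ^ 2 * (∫ ω, X i ω ^ 2 ∂P) / 2)) := by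
    rw [← exp_sum, Finset.sum_neg_distrib, ← Finset.sum_div, ← Finset.mul_sum]
  rw [hind.charFun_map_fun_sum_eq_prod hm, Finset.prod_apply, hgauss, Complex.ofReal_prod,
    Finset.mul_sum, Finset.mul_sum]
  refine (norm_prod_sub_prod_le _ _ _ (fun i _ => ?_) fun i _ => ?_).trans
    (Finset.sum_le_sum fun i _ => norm_charFun_map_sub_exp_le (hX i) (h₀ i) hu)
  · have := Measure.isProbabilityMeasure_map (hm i)
    exact norm_charFun_le_one u
  · rw [Complex.norm_real, norm_of_nonneg (exp_pos _).le, exp_le_one_iff, Left.neg_nonpos_iff]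
    have : 0 ≤ ∫ ω, X i ω ^ 2 ∂P := integral_nonneg fun ω => sq_nonneg _
    positivity

theorem isNearGaussian_map_sum (hX : ∀ i, MemLp (X i) 3 P) (h₀ : ∀ i, ∫ ω, X i ω ∂P = 0)
    (hind : iIndepFun X P) (hs : ∑ i, ∫ ω, X i ω ^ 2 ∂P = s ^ 2) (hC : 0 < C)
    (hρ : ∑ i, ∫ ω, |X i ω| ^ 3 ∂P ≤ C * s ^ 2) :
    IsNearGaussian (P.map fun ω => ∑ i, X i ω) s C := by
  have hcube (u : ℝ) (hu : 0 ≤ u) : u ^ 3 * ∑ i, ∫ ω, |X i ω| ^ 3 ∂P ≤ u ^ 3 * (C * s ^ 2) := by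
    gcongr
  refine ⟨fun u ⟨hu, huC⟩ => ?_, fun u hu => ?_⟩
  · have h16 : 16 * C * u ≤ 1 := by
      rw [le_div_iff₀ (by positivity)] at huC
      linarith
    refine (norm_charFun_map_sum_le hX h₀ hind hu).trans ?_
    rw [exp_le_exp, hs]
    nlinarith [hcube u hu, sq_nonneg (s * u)]
  · have h := norm_charFun_map_sum_sub_exp_le hX h₀ hind hu
    rw [hs, ← mul_pow, mul_comm u s] at h
    linarith [hcube u hu]

end Sum

end ThirdMoment

theorem existsUnique_isMinOn_Ioo_of_strictConvexOn {f : ℝ → ℝ} {a b : ℝ}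
    (hf : StrictConvexOn ℝ (Icc a b) f) (hc : ContinuousOn f (Icc a b)) (hab : a < b)
    (hfab : f a = f b) :
    ∃! x, x ∈ Ioo a b ∧ IsMinOn f (Ioo a b) x := by
  obtain ⟨x, hx, hmin⟩ := isCompact_Icc.exists_isMinOn (nonempty_Icc.2 hab.le) hc
  obtain ⟨m, hm⟩ : (Ioo a b).Nonempty := nonempty_Ioo.2 hab
  have hlt : f x < f a := by
    refine (hmin (Ioo_subset_Icc_self hm)).trans_lt ?_
    simpa [hfab] using hf.lt_on_openSegment (left_mem_Icc.2 hab.le) (right_mem_Icc.2 hab.le)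
      hab.ne (openSegment_eq_Ioo hab ▸ hm)
  have hx' : x ∈ Ioo a b := by
    refine ⟨hx.1.lt_of_ne ?_, hx.2.lt_of_ne ?_⟩ <;> rintro rfl
    · exact hlt.false
    · exact (hfab ▸ hlt).false
  have hmin' := hmin.on_subset Ioo_subset_Icc_self
  exact ⟨x, ⟨hx', hmin'⟩, fun y hy =>
    (hf.subset Ioo_subset_Icc_self (convex_Ioo a b)).eq_of_isMinOn hy.2 hmin' hy.1 hx'⟩

section Tilting

variable {Ω : Type*} [MeasurableSpace Ω] {P : Measure Ω} {X : Ω → ℝ} {a b t : ℝ}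

theorem Icc_subset_integrableExpSet (ha : a ∈ integrableExpSet X P)
    (hb : b ∈ integrableExpSet X P) : Icc a b ⊆ integrableExpSet X P := fun _ ht =>
  integrable_exp_mul_of_le_of_le ha hb ht.1 ht.2

theorem Ioo_subset_interior_integrableExpSet (ha : a ∈ integrableExpSet X P)
    (hb : b ∈ integrableExpSet X P) : Ioo a b ⊆ interior (integrableExpSet X P) :=
  interior_maximal (Ioo_subset_Icc_self.trans (Icc_subset_integrableExpSet ha hb)) isOpen_Ioo

theorem exp_mul_le_add (ht : t ∈ Icc a b) (x : ℝ) : exp (t * x) ≤ exp (a * x) + exp (b * x) := by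
  rcases le_total 0 x with hx | hx
  · exact (exp_le_exp.2 (mul_le_mul_of_nonneg_right ht.2 hx)).trans
      (le_add_of_nonneg_left (exp_pos _).le)
  · exact (exp_le_exp.2 (mul_le_mul_of_nonpos_right ht.1 hx)).trans
      (le_add_of_nonneg_right (exp_pos _).le)

theorem continuousOn_mgf_Icc (ha : a ∈ integrableExpSet X P) (hb : b ∈ integrableExpSet X P) :
    ContinuousOn (mgf X P) (Icc a b) := by
  refine continuousOn_of_dominated (bound := fun ω => exp (a * X ω) + exp (b * X ω))
    (fun t ht => (Icc_subset_integrableExpSet ha hb ht).aestronglyMeasurable)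
    (fun t ht => ae_of_all _ fun ω => ?_) (ha.add hb) (ae_of_all _ fun ω => by fun_prop)
  rw [norm_of_nonneg (exp_pos _).le]
  exact exp_mul_le_add ht _

variable [IsProbabilityMeasure P]

theorem continuousOn_cgf_Icc (ha : a ∈ integrableExpSet X P) (hb : b ∈ integrableExpSet X P) :
    ContinuousOn (cgf X P) (Icc a b) :=
  (continuousOn_mgf_Icc ha hb).log fun _ ht =>
    (mgf_pos (Icc_subset_integrableExpSet ha hb ht)).ne'

theorem variance_tilted_pos (ht : t ∈ interior (integrableExpSet X P))
    (hX : ∀ c, ¬ X =ᵐ[P] fun _ => c) : 0 < Var[X; P.tilted fun ω => t * X ω] := by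
  have hint : t ∈ integrableExpSet X P := interior_subset ht
  have := isProbabilityMeasure_tilted hint
  refine (variance_nonneg _ _).lt_of_ne' fun h₀ =>
    hX (∫ ω, X ω ∂P.tilted fun ω => t * X ω) ?_
  exact (absolutelyContinuous_tilted hint).ae_le
    (ae_eq_integral_of_variance_eq_zero (memLp_tilted_mul ht 2) h₀)

theorem strictConvexOn_cgf_Icc (ha : a ∈ integrableExpSet X P) (hb : b ∈ integrableExpSet X P)
    (hX : ∀ c, ¬ X =ᵐ[P] fun _ => c) : StrictConvexOn ℝ (Icc a b) (cgf X P) := by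
  refine strictConvexOn_of_deriv2_pos (convex_Icc a b) (continuousOn_cgf_Icc ha hb) fun t ht => ?_
  rw [interior_Icc] at ht
  have ht' := Ioo_subset_interior_integrableExpSet ha hb ht
  rw [← iteratedDeriv_eq_iterate, ← variance_tilted_mul ht']
  exact variance_tilted_pos ht' hX

end Tilting

section Law

variable {S : Type*} [MeasurableSpace S] {μ : Measure S} {f : S → ℝ}

theorem IsDensity.integrable (hf : IsDensity μ f) : Integrable f μ := by
  refine ⟨hf.measurable.aestronglyMeasurable, ?_⟩
  rw [hasFiniteIntegral_iff_ofReal (ae_of_all _ hf.nonneg), hf.lintegral_eq_one]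
  exact ENNReal.one_lt_top

theorem IsDensity.integral_eq_one (hf : IsDensity μ f) : ∫ x, f x ∂μ = 1 := by
  rw [integral_eq_lintegral_of_nonneg_ae (ae_of_all _ hf.nonneg)
    hf.measurable.aestronglyMeasurable, hf.lintegral_eq_one, ENNReal.toReal_one]

theorem IsDensity.isProbabilityMeasure (hf : IsDensity μ f) : IsProbabilityMeasure (law μ f) :=
  ⟨by rw [law, withDensity_apply _ .univ, setLIntegral_univ, hf.lintegral_eq_one]⟩

theorem IsDensity.integrable_law_iff (hf : IsDensity μ f) {h : S → ℝ} :
    Integrable h (law μ f) ↔ Integrable (fun x => f x * h x) μ := by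
  rw [law, integrable_withDensity_iff_integrable_smul' hf.measurable.ennreal_ofReal
    (ae_of_all _ fun x => ENNReal.ofReal_lt_top)]
  simp only [ENNReal.toReal_ofReal (hf.nonneg _), smul_eq_mul]

theorem IsDensity.integral_law (hf : IsDensity μ f) (h : S → ℝ) :
    ∫ x, h x ∂(law μ f) = ∫ x, f x * h x ∂μ := by
  rw [law, integral_withDensity_eq_integral_toReal_smul hf.measurable.ennreal_ofReal
    (ae_of_all _ fun x => ENNReal.ofReal_lt_top)]
  simp only [ENNReal.toReal_ofReal (hf.nonneg _), smul_eq_mul]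

theorem IsDensity.ae_law_iff (hf : IsDensity μ f) {p : S → Prop} :
    (∀ᵐ x ∂(law μ f), p x) ↔ ∀ᵐ x ∂μ, f x ≠ 0 → p x := by
  rw [law, ae_withDensity_iff hf.measurable.ennreal_ofReal]
  refine eventually_congr (ae_of_all _ fun x => ?_)
  rw [ne_eq, ENNReal.ofReal_eq_zero, (hf.nonneg x).ge_iff_eq']

theorem IsDensity.ae_ne_zero (hf : IsDensity μ f) : ∀ᵐ x ∂(law μ f), f x ≠ 0 :=
  hf.ae_law_iff.2 (ae_of_all _ fun _ => id)

theorem IsDensity.law_real_apply (hf : IsDensity μ f) {s : Set S} (hs : MeasurableSet s) :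
    (law μ f).real s = ∫ x in s, f x ∂μ := by
  rw [Measure.real, law, withDensity_apply _ hs, integral_eq_lintegral_of_nonneg_ae
    (ae_of_all _ hf.nonneg) hf.measurable.aestronglyMeasurable]

theorem eq_min_of_ne_of_le {a : Fin 2 → ℝ} {z w : Fin 2} (hwz : w ≠ z) (h : a z ≤ a w) :
    a z = min (a 0) (a 1) := by
  fin_cases z <;> fin_cases w <;> simp_all

theorem affinity_eq_two_mul_errorProb {φ : Fin 2 → S → ℝ} (hφ : ∀ z, IsDensity μ (φ z))
    {zhat : S → Fin 2} (hz : IsBayesEstimator φ zhat) :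
    affinity μ (φ 0) (φ 1) = 2 * errorProb μ φ zhat := by
  have hs (z : Fin 2) : MeasurableSet {x | zhat x ≠ z} := (hz.1 (measurableSet_singleton z)).compl
  have herr (z : Fin 2) : (law μ (φ z)).real {x | zhat x ≠ z}
      = ∫ x in {x | zhat x ≠ z}, min (φ 0 x) (φ 1 x) ∂μ := by
    rw [(hφ z).law_real_apply (hs z)]
    exact setIntegral_congr_fun (hs z) fun x hx =>
      eq_min_of_ne_of_le (a := fun z => φ z x) hx (hz.2 x z)
  have hcompl : {x | zhat x ≠ 1} = {x | zhat x ≠ 0}ᶜ := by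
    ext x
    simp only [mem_ofPred_eq, mem_compl_iff]
    lia
  have hmin : Integrable (fun x => min (φ 0 x) (φ 1 x)) μ :=
    (hφ 0).integrable.inf (hφ 1).integrable
  rw [affinity, errorProb, Fin.sum_univ_two, herr, herr, hcompl, integral_add_compl (hs 0) hmin]
  ring

end Law

theorem neg_logLR {S : Type*} (f g : S → ℝ) : -logLR f g = logLR g f := by
  funext x
  rw [Pi.neg_apply, logLR, logLR, ← log_inv, inv_div]

theorem gFun_eq (α x : ℝ) : gFun α x = exp (α * x) * min 1 (exp (-x)) := by
  rw [gFun, exp_monotone.map_min, mul_min_of_nonneg _ _ (exp_pos _).le, mul_one, ← exp_add]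
  ring_nf

/-- Two probability densities whose laws are mutually absolutely continuous, so that the
log-likelihood ratio is meaningful almost everywhere for both laws. -/
structure IsEquivPair {S : Type*} [MeasurableSpace S] (μ : Measure S) (f g : S → ℝ) : Prop where
  left : IsDensity μ f
  right : IsDensity μ g
  ac : law μ f ≪ law μ g
  symm_ac : law μ g ≪ law μ f

namespace IsEquivPair

variable {S : Type*} [MeasurableSpace S] {μ : Measure S} {f g : S → ℝ} {α : ℝ}

theorem measurable_logLR (h : IsEquivPair μ f g) : Measurable (logLR f g) :=
  measurable_log.comp (h.left.measurable.div h.right.measurable)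

theorem ae_eq_zero_iff (h : IsEquivPair μ f g) : ∀ᵐ x ∂μ, f x = 0 ↔ g x = 0 := by
  filter_upwards [h.left.ae_law_iff.1 (h.ac.ae_le h.right.ae_ne_zero),
    h.right.ae_law_iff.1 (h.symm_ac.ae_le h.left.ae_ne_zero)] with x hf hg
  exact not_iff_not.1 ⟨hf, hg⟩

theorem ae_eq_mul_exp_logLR (h : IsEquivPair μ f g) :
    ∀ᵐ x ∂μ, g x = f x * exp (logLR g f x) := by
  filter_upwards [h.ae_eq_zero_iff] with x hx
  rcases (h.left.nonneg x).eq_or_lt' with hf | hf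
  · rw [hf, hx.1 hf, zero_mul]
  · have hg : 0 < g x := (h.right.nonneg x).lt_of_ne' (hx.not.1 hf.ne')
    rw [logLR, exp_log (div_pos hg hf), mul_div_cancel₀ _ hf.ne']

theorem rpow_mul_rpow_ae_eq (h : IsEquivPair μ f g) (α : ℝ) :
    (fun x => f x ^ (1 - α) * g x ^ α) =ᵐ[μ] fun x => f x * exp (α * logLR g f x) := by
  filter_upwards [h.ae_eq_mul_exp_logLR] with x hx
  have hf := h.left.nonneg x
  rw [hx, mul_rpow hf (exp_pos _).le, ← mul_assoc, ← rpow_add' hf (by simp), sub_add_cancel,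
    rpow_one, ← exp_mul, mul_comm α]

theorem integral_rpow_mul_rpow (h : IsEquivPair μ f g) (α : ℝ) :
    ∫ x, f x ^ (1 - α) * g x ^ α ∂μ = mgf (logLR g f) (law μ f) α := by
  rw [mgf, h.left.integral_law]
  exact integral_congr_ae (h.rpow_mul_rpow_ae_eq α)

theorem chernoffDiv_eq_neg_cgf (h : IsEquivPair μ f g) (α : ℝ) :
    chernoffDiv μ f g α = -cgf (logLR g f) (law μ f) α := by
  rw [chernoffDiv, h.integral_rpow_mul_rpow, cgf]

theorem zero_mem_integrableExpSet (h : IsEquivPair μ f g) :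
    0 ∈ integrableExpSet (logLR g f) (law μ f) := by
  have := h.left.isProbabilityMeasure
  simp [integrableExpSet]

theorem one_mem_integrableExpSet (h : IsEquivPair μ f g) :
    1 ∈ integrableExpSet (logLR g f) (law μ f) := by
  refine h.left.integrable_law_iff.2 (h.right.integrable.congr ?_)
  filter_upwards [h.ae_eq_mul_exp_logLR] with x hx
  rw [hx, one_mul]

theorem mem_integrableExpSet (h : IsEquivPair μ f g) (hα : α ∈ Icc 0 1) :
    α ∈ integrableExpSet (logLR g f) (law μ f) :=
  Icc_subset_integrableExpSet h.zero_mem_integrableExpSet h.one_mem_integrableExpSet hα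

theorem mem_interior_integrableExpSet (h : IsEquivPair μ f g) (hα : α ∈ Ioo 0 1) :
    α ∈ interior (integrableExpSet (logLR g f) (law μ f)) :=
  Ioo_subset_interior_integrableExpSet h.zero_mem_integrableExpSet h.one_mem_integrableExpSet hα

theorem exp_neg_chernoffDiv (h : IsEquivPair μ f g) (hα : α ∈ Icc 0 1) :
    exp (-chernoffDiv μ f g α) = mgf (logLR g f) (law μ f) α := by
  have := h.left.isProbabilityMeasure
  rw [h.chernoffDiv_eq_neg_cgf, neg_neg, exp_cgf (h.mem_integrableExpSet hα)]

theorem tilted_one (h : IsEquivPair μ f g) : tilted μ f g 1 = g := by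
  funext x
  simp [tilted, chernoffDiv, h.right.integral_eq_one]

theorem law_tilted (h : IsEquivPair μ f g) (hα : α ∈ Icc 0 1) :
    law μ (tilted μ f g α) = (law μ f).tilted fun x => α * logLR g f x := by
  have hmeas := h.left.measurable
  have hmeas' := h.right.measurable
  rw [Measure.tilted, law, law, ← withDensity_mul _ (by fun_prop)
    (by unfold logLR; fun_prop)]
  refine withDensity_congr_ae ?_
  filter_upwards [h.rpow_mul_rpow_ae_eq α] with x hx
  rw [tilted, hx, Pi.mul_apply, ← ENNReal.ofReal_mul (h.left.nonneg x), mul_assoc,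
    ← neg_neg (chernoffDiv μ f g α), exp_neg, h.exp_neg_chernoffDiv hα, mgf, div_eq_mul_inv, law]

theorem isDensity_tilted (h : IsEquivPair μ f g) (hα : α ∈ Icc 0 1) :
    IsDensity μ (tilted μ f g α) where
  measurable := ((h.left.measurable.pow_const _).mul (h.right.measurable.pow_const _)).mul_const _
  nonneg x := mul_nonneg (mul_nonneg (rpow_nonneg (h.left.nonneg x) _)
    (rpow_nonneg (h.right.nonneg x) _)) (exp_pos _).le
  lintegral_eq_one := by
    have := h.left.isProbabilityMeasure
    have hprob := isProbabilityMeasure_tilted (h.mem_integrableExpSet hα)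
    rw [← h.law_tilted hα] at hprob
    simpa [law] using hprob.measure_univ

theorem not_logLR_ae_eq_const (h : IsEquivPair μ f g) (hne : law μ f ≠ law μ g) (c : ℝ) :
    ¬ logLR g f =ᵐ[law μ f] fun _ => c := by
  have := h.left.isProbabilityMeasure
  refine fun hc => hne ?_
  have hg := h.law_tilted (right_mem_Icc.2 zero_le_one)
  simp only [one_mul] at hg
  rwa [h.tilted_one, tilted_congr hc, tilted_const, eq_comm] at hg

theorem existsUnique_isChernoffArgmax (h : IsEquivPair μ f g) (hne : law μ f ≠ law μ g) :
    ∃! α, IsChernoffArgmax μ f g α := by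
  have := h.left.isProbabilityMeasure
  have hcgf : cgf (logLR g f) (law μ f) 0 = cgf (logLR g f) (law μ f) 1 := by
    rw [cgf_zero, cgf, ← h.integral_rpow_mul_rpow]
    simp [h.right.integral_eq_one]
  simpa only [IsChernoffArgmax, isMaxOn_iff, h.chernoffDiv_eq_neg_cgf, neg_le_neg_iff, isMinOn_iff]
    using existsUnique_isMinOn_Ioo_of_strictConvexOn
      (strictConvexOn_cgf_Icc h.zero_mem_integrableExpSet h.one_mem_integrableExpSet
        (h.not_logLR_ae_eq_const hne))
      (continuousOn_cgf_Icc h.zero_mem_integrableExpSet h.one_mem_integrableExpSet)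
      zero_lt_one hcgf

theorem memLp_logLR (h : IsEquivPair μ f g) (hα : α ∈ Ioo 0 1) (p : ℝ≥0) :
    MemLp (logLR f g) p (law μ (tilted μ f g α)) := by
  have hp := memLp_tilted_mul (h.mem_interior_integrableExpSet hα) p
  rw [← h.law_tilted (Ioo_subset_Icc_self hα)] at hp
  simpa only [neg_logLR] using hp.neg

theorem variance_logLR_pos (h : IsEquivPair μ f g) (hne : law μ f ≠ law μ g) (hα : α ∈ Ioo 0 1) :
    0 < Var[logLR f g; law μ (tilted μ f g α)] := by
  have := h.left.isProbabilityMeasure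
  have hpos := variance_tilted_pos (h.mem_interior_integrableExpSet hα)
    (h.not_logLR_ae_eq_const hne)
  rwa [← h.law_tilted (Ioo_subset_Icc_self hα), ← variance_neg, neg_logLR] at hpos

theorem integral_logLR_eq_zero (h : IsEquivPair μ f g) (hα : IsChernoffArgmax μ f g α) :
    ∫ x, logLR f g x ∂(law μ (tilted μ f g α)) = 0 := by
  have hderiv := (hα.2.isLocalMax (Ioo_mem_nhds hα.1.1 hα.1.2)).deriv_eq_zero
  rwa [funext h.chernoffDiv_eq_neg_cgf, deriv.fun_neg,
    ← integral_tilted_mul_self (h.mem_interior_integrableExpSet hα.1), ← integral_neg',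
    neg_logLR, ← h.law_tilted (Ioo_subset_Icc_self hα.1)] at hderiv

theorem integral_centredLLR (h : IsEquivPair μ f g) (hα : α ∈ Ioo 0 1) :
    ∫ x, centredLLR μ f g α x ∂(law μ (tilted μ f g α)) = 0 := by
  have := (h.isDensity_tilted (Ioo_subset_Icc_self hα)).isProbabilityMeasure
  simp only [centredLLR]
  rw [integral_sub ((h.memLp_logLR hα 1).integrable le_rfl) (integrable_const _)]
  simp

theorem memLp_centredLLR (h : IsEquivPair μ f g) (hα : α ∈ Ioo 0 1) (p : ℝ≥0) :
    MemLp (centredLLR μ f g α) p (law μ (tilted μ f g α)) := by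
  have := (h.isDensity_tilted (Ioo_subset_Icc_self hα)).isProbabilityMeasure
  exact (h.memLp_logLR hα p).sub (memLp_const _)

theorem ae_ne_zero (h : IsEquivPair μ f g) (hα : α ∈ Icc 0 1) :
    ∀ᵐ x ∂law μ (tilted μ f g α), f x ≠ 0 ∧ g x ≠ 0 := by
  rw [h.law_tilted hα]
  exact (tilted_absolutelyContinuous _ _).ae_le
    (h.left.ae_ne_zero.and (h.ac.ae_le h.right.ae_ne_zero))

theorem affinity_eq (h : IsEquivPair μ f g) (hα : α ∈ Icc 0 1) :
    affinity μ f g = (∫ x, gFun α (logLR f g x) ∂law μ (tilted μ f g α))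
      * exp (-chernoffDiv μ f g α) := by
  have := h.left.isProbabilityMeasure
  have hmgf := mgf_pos (h.mem_integrableExpSet hα)
  rw [h.exp_neg_chernoffDiv hα, h.law_tilted hα, integral_tilted_mul_eq_mgf, ← integral_mul_const,
    h.left.integral_law, affinity]
  refine integral_congr_ae ?_
  filter_upwards [h.ae_eq_mul_exp_logLR] with x hx
  rw [hx, gFun_eq, ← neg_logLR g f, Pi.neg_apply, neg_neg, mul_neg, exp_neg, smul_eq_mul]
  field_simp
  rw [mul_min_of_nonneg _ _ (h.left.nonneg x), mul_one]

end IsEquivPair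

theorem IsChernoffArgmax.chernoffInfo_eq {S : Type*} [MeasurableSpace S] {μ : Measure S}
    {f g : S → ℝ} {α : ℝ} (hα : IsChernoffArgmax μ f g α) :
    chernoffInfo μ f g = chernoffDiv μ f g α :=
  IsGreatest.csSup_eq ⟨mem_image_of_mem _ hα.1, forall_mem_image.2 hα.2⟩

section Pi

variable {ι : Type*} [Fintype ι] {Ω : ι → Type*} [∀ i, MeasurableSpace (Ω i)]
  {μ : (i : ι) → Measure (Ω i)} [∀ i, SigmaFinite (μ i)] {f : (i : ι) → Ω i → ℝ}

theorem isDensity_pi (hf : ∀ i, IsDensity (μ i) (f i)) :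
    IsDensity (Measure.pi μ) fun x => ∏ i, f i (x i) where
  measurable := Finset.measurable_prod _ fun i _ =>
    (hf i).measurable.comp (measurable_pi_apply i)
  nonneg x := Finset.prod_nonneg fun i _ => (hf i).nonneg _
  lintegral_eq_one := by
    rw [← ofReal_integral_eq_lintegral_ofReal
      (Integrable.fintype_prod_dep fun i => (hf i).integrable)
      (ae_of_all _ fun x => Finset.prod_nonneg fun i _ => (hf i).nonneg _),
      integral_fintype_prod_eq_prod, Finset.prod_eq_one fun i _ => (hf i).integral_eq_one,
      ENNReal.ofReal_one]

theorem law_pi (hf : ∀ i, IsDensity (μ i) (f i)) :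
    law (Measure.pi μ) (fun x => ∏ i, f i (x i)) = Measure.pi fun i => law (μ i) (f i) := by
  have (i : ι) := (hf i).isProbabilityMeasure
  have := (isDensity_pi hf).isProbabilityMeasure
  refine (Measure.pi_eq fun s hs => ?_).symm
  have hreal : (law (Measure.pi μ) fun x => ∏ i, f i (x i)).real (univ.pi s)
      = ∏ i, (law (μ i) (f i)).real (s i) := by
    rw [(isDensity_pi hf).law_real_apply (.univ_pi hs), Measure.restrict_pi_pi,
      integral_fintype_prod_eq_prod]
    exact Finset.prod_congr rfl fun i _ => ((hf i).law_real_apply (hs i)).symm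
  rw [← ofReal_measureReal, hreal, ENNReal.ofReal_prod_of_nonneg fun _ _ => measureReal_nonneg]
  exact Finset.prod_congr rfl fun i _ => ofReal_measureReal

end Pi

section Product

variable {n : ℕ} {Ω : Fin n → Type*} [∀ j, MeasurableSpace (Ω j)]
  {μ : (j : Fin n) → Measure (Ω j)} {φ : Fin 2 → (j : Fin n) → Ω j → ℝ} {α : ℝ}

theorem sq_sqrt_mul_sigmaBar (μ : (j : Fin n) → Measure (Ω j))
    (φ : Fin 2 → (j : Fin n) → Ω j → ℝ) (α : ℝ) :
    (√n * sigmaBar μ φ α) ^ 2 = ∑ j, Var[coordZ μ φ α j; coordLaw μ φ α j] := by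
  have hvar : 0 ≤ ∑ j, Var[coordZ μ φ α j; coordLaw μ φ α j] :=
    Finset.sum_nonneg fun j _ => variance_nonneg _ _
  rcases n.eq_zero_or_pos with rfl | hn
  · simp
  · rw [sigmaBar, mul_pow, sq_sqrt n.cast_nonneg, sq_sqrt (by positivity)]
    field_simp

theorem expG_eq_integral_map (h : IsEquivPair (Measure.pi μ) (prodDensity φ 0) (prodDensity φ 1)) :
    expG μ φ α = ∫ x, gFun α x ∂(law (Measure.pi μ)
      (tilted (Measure.pi μ) (prodDensity φ 0) (prodDensity φ 1) α)).map
        (logLR (prodDensity φ 0) (prodDensity φ 1)) := by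
  rw [integral_map h.measurable_logLR.aemeasurable (continuous_gFun α).aestronglyMeasurable, expG]

theorem logLR_prodDensity_ae_eq (hj : ∀ j, IsEquivPair (μ j) (φ 0 j) (φ 1 j))
    (hα : α ∈ Icc 0 1) :
    logLR (prodDensity φ 0) (prodDensity φ 1) =ᵐ[Measure.pi (coordLaw μ φ α)]
      ∑ j, fun x => logLR (φ 0 j) (φ 1 j) (x j) := by
  have hprob (j : Fin n) : IsProbabilityMeasure (coordLaw μ φ α j) :=
    ((hj j).isDensity_tilted hα).isProbabilityMeasure
  have hne : ∀ᵐ x ∂Measure.pi (coordLaw μ φ α), ∀ j, φ 0 j (x j) ≠ 0 ∧ φ 1 j (x j) ≠ 0 :=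
    ae_all_iff.2 fun j => (measurePreserving_eval (coordLaw μ φ α) j).quasiMeasurePreserving.ae
      ((hj j).ae_ne_zero hα)
  filter_upwards [hne] with x hx
  simp only [logLR, prodDensity, Finset.sum_apply]
  rw [← Finset.prod_div_distrib, log_prod fun j _ => div_ne_zero (hx j).1 (hx j).2]

theorem affinity_eq_expG_mul (h : IsEquivPair (Measure.pi μ) (prodDensity φ 0) (prodDensity φ 1))
    (hα : IsChernoffArgmax (Measure.pi μ) (prodDensity φ 0) (prodDensity φ 1) α) :
    affinity (Measure.pi μ) (prodDensity φ 0) (prodDensity φ 1)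
      = expG μ φ α * exp (-chernoffInfo (Measure.pi μ) (prodDensity φ 0) (prodDensity φ 1)) := by
  rw [h.affinity_eq (Ioo_subset_Icc_self hα.1), hα.chernoffInfo_eq, expG]

theorem variance_logLR_prodDensity (hj : ∀ j, IsEquivPair (μ j) (φ 0 j) (φ 1 j))
    (hα : α ∈ Ioo 0 1) :
    Var[logLR (prodDensity φ 0) (prodDensity φ 1); Measure.pi (coordLaw μ φ α)]
      = (√n * sigmaBar μ φ α) ^ 2 := by
  have hα' := Ioo_subset_Icc_self hα
  have hprob (j : Fin n) : IsProbabilityMeasure (coordLaw μ φ α j) :=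
    ((hj j).isDensity_tilted hα').isProbabilityMeasure
  rw [variance_congr (logLR_prodDensity_ae_eq hj hα'), sq_sqrt_mul_sigmaBar,
    variance_sum_pi (μ := coordLaw μ φ α) fun j => (hj j).memLp_logLR hα 2]
  exact Finset.sum_congr rfl fun j _ =>
    (variance_sub_const (hj j).measurable_logLR.aestronglyMeasurable _).symm

theorem InFamily.absolutelyContinuous (h : InFamily μ φ) (z w : Fin 2) :
    law (Measure.pi μ) (prodDensity φ z) ≪ law (Measure.pi μ) (prodDensity φ w) := by
  rcases eq_or_ne z w with rfl | hzw
  · exact .rfl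
  · exact (InformationTheory.klDiv_ne_top_iff.1 (h.kl_lt_top z w hzw).ne).1

variable [∀ j, SigmaFinite (μ j)]

theorem IsEquivPair.coord (hφ : ∀ z j, IsDensity (μ j) (φ z j))
    (h : IsEquivPair (Measure.pi μ) (prodDensity φ 0) (prodDensity φ 1)) (j : Fin n) :
    IsEquivPair (μ j) (φ 0 j) (φ 1 j) := by
  have (z : Fin 2) (j : Fin n) := (hφ z j).isProbabilityMeasure
  have hmap (z : Fin 2) :
      (law (Measure.pi μ) (prodDensity φ z)).map (Function.eval j) = law (μ j) (φ z j) := by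
    change (law (Measure.pi μ) fun x => ∏ j, φ z j (x j)).map _ = _
    rw [law_pi (hφ z), (measurePreserving_eval _ j).map_eq]
  refine ⟨hφ 0 j, hφ 1 j, ?_, ?_⟩ <;> rw [← hmap 0, ← hmap 1]
  exacts [h.ac.map (measurable_pi_apply j), h.symm_ac.map (measurable_pi_apply j)]

theorem chernoffDiv_prodDensity (hj : ∀ j, IsEquivPair (μ j) (φ 0 j) (φ 1 j))
    (hα : α ∈ Icc 0 1) :
    chernoffDiv (Measure.pi μ) (prodDensity φ 0) (prodDensity φ 1) α
      = ∑ j, chernoffDiv (μ j) (φ 0 j) (φ 1 j) α := by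
  have hpos (j : Fin n) : ∫ x, φ 0 j x ^ (1 - α) * φ 1 j x ^ α ∂μ j ≠ 0 := by
    have := (hj j).left.isProbabilityMeasure
    rw [(hj j).integral_rpow_mul_rpow]
    exact (mgf_pos ((hj j).mem_integrableExpSet hα)).ne'
  have hprod (x : (j : Fin n) → Ω j) : prodDensity φ 0 x ^ (1 - α) * prodDensity φ 1 x ^ α
      = ∏ j, φ 0 j (x j) ^ (1 - α) * φ 1 j (x j) ^ α := by
    rw [prodDensity, prodDensity, Finset.prod_mul_distrib,
      finsetProd_rpow _ _ fun j _ => (hj j).left.nonneg _,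
      finsetProd_rpow _ _ fun j _ => (hj j).right.nonneg _]
  simp only [chernoffDiv, hprod, Finset.sum_neg_distrib]
  rw [integral_fintype_prod_eq_prod fun j x => φ 0 j x ^ (1 - α) * φ 1 j x ^ α,
    log_prod fun j _ => hpos j]

theorem tilted_prodDensity (hj : ∀ j, IsEquivPair (μ j) (φ 0 j) (φ 1 j)) (hα : α ∈ Icc 0 1) :
    tilted (Measure.pi μ) (prodDensity φ 0) (prodDensity φ 1) α
      = fun x => ∏ j, tilted (μ j) (φ 0 j) (φ 1 j) α (x j) := by
  funext x
  simp only [tilted, Finset.prod_mul_distrib]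
  rw [chernoffDiv_prodDensity hj hα, exp_sum, prodDensity, prodDensity,
    finsetProd_rpow _ _ fun j _ => (hj j).left.nonneg _,
    finsetProd_rpow _ _ fun j _ => (hj j).right.nonneg _]

theorem law_tilted_prodDensity (hj : ∀ j, IsEquivPair (μ j) (φ 0 j) (φ 1 j))
    (hα : α ∈ Icc 0 1) :
    law (Measure.pi μ) (tilted (Measure.pi μ) (prodDensity φ 0) (prodDensity φ 1) α)
      = Measure.pi (coordLaw μ φ α) := by
  rw [tilted_prodDensity hj hα, law_pi fun j => (hj j).isDensity_tilted hα]
  rfl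

theorem sqrt_mul_sigmaBar_pos (hj : ∀ j, IsEquivPair (μ j) (φ 0 j) (φ 1 j))
    (h : IsEquivPair (Measure.pi μ) (prodDensity φ 0) (prodDensity φ 1))
    (hne : law (Measure.pi μ) (prodDensity φ 0) ≠ law (Measure.pi μ) (prodDensity φ 1))
    (hα : α ∈ Ioo 0 1) : 0 < √n * sigmaBar μ φ α := by
  have hvar := h.variance_logLR_pos hne hα
  rw [law_tilted_prodDensity hj (Ioo_subset_Icc_self hα), variance_logLR_prodDensity hj hα] at hvar
  exact (mul_nonneg (sqrt_nonneg _) (sqrt_nonneg _)).lt_of_ne' (sq_pos_iff.1 hvar)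

theorem logLR_prodDensity_ae_eq_sum_coordZ (hj : ∀ j, IsEquivPair (μ j) (φ 0 j) (φ 1 j))
    (h : IsEquivPair (Measure.pi μ) (prodDensity φ 0) (prodDensity φ 1))
    (hα : IsChernoffArgmax (Measure.pi μ) (prodDensity φ 0) (prodDensity φ 1) α) :
    logLR (prodDensity φ 0) (prodDensity φ 1) =ᵐ[Measure.pi (coordLaw μ φ α)]
      fun x => ∑ j, coordZ μ φ α j (x j) := by
  have hα' := Ioo_subset_Icc_self hα.1
  have hprob (j : Fin n) : IsProbabilityMeasure (coordLaw μ φ α j) :=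
    ((hj j).isDensity_tilted hα').isProbabilityMeasure
  have hint (j : Fin n) : Integrable (logLR (φ 0 j) (φ 1 j)) (coordLaw μ φ α j) :=
    memLp_one_iff_integrable.1 ((hj j).memLp_logLR hα.1 1)
  have hmean : ∑ j, ∫ x, logLR (φ 0 j) (φ 1 j) x ∂coordLaw μ φ α j = 0 := by
    rw [← h.integral_logLR_eq_zero hα, law_tilted_prodDensity hj hα',
      integral_congr_ae (logLR_prodDensity_ae_eq hj hα')]
    simp only [Finset.sum_apply]
    rw [integral_finsetSum _ fun j _ => integrable_comp_eval (μ := coordLaw μ φ α) (hint j)]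
    exact Finset.sum_congr rfl fun j _ =>
      (integral_comp_eval (hj j).measurable_logLR.aestronglyMeasurable).symm
  filter_upwards [logLR_prodDensity_ae_eq hj hα'] with x hx
  simp only [coordLaw] at hmean
  simp only [hx, Finset.sum_apply, coordZ, centredLLR, Finset.sum_sub_distrib, hmean, sub_zero]

theorem isNearGaussian_map_logLR (hj : ∀ j, IsEquivPair (μ j) (φ 0 j) (φ 1 j))
    (h : IsEquivPair (Measure.pi μ) (prodDensity φ 0) (prodDensity φ 1))
    (hα : IsChernoffArgmax (Measure.pi μ) (prodDensity φ 0) (prodDensity φ 1) α) {C : ℝ}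
    (hC : 0 < C) (hρ : ∑ j, ∫ y, |coordZ μ φ α j y| ^ 3 ∂coordLaw μ φ α j
      ≤ C * (√n * sigmaBar μ φ α) ^ 2) :
    IsNearGaussian ((law (Measure.pi μ)
      (tilted (Measure.pi μ) (prodDensity φ 0) (prodDensity φ 1) α)).map
        (logLR (prodDensity φ 0) (prodDensity φ 1))) (√n * sigmaBar μ φ α) C := by
  have hα' := Ioo_subset_Icc_self hα.1
  have hprob (j : Fin n) : IsProbabilityMeasure (coordLaw μ φ α j) :=
    ((hj j).isDensity_tilted hα').isProbabilityMeasure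
  have hmem (j : Fin n) : MemLp (coordZ μ φ α j) 3 (coordLaw μ φ α j) :=
    (hj j).memLp_centredLLR hα.1 3
  have hmean (j : Fin n) : ∫ y, coordZ μ φ α j y ∂coordLaw μ φ α j = 0 :=
    (hj j).integral_centredLLR hα.1
  have heval (j : Fin n) {F : ℝ → ℝ} (hF : Continuous F) :
      ∫ x, F (coordZ μ φ α j (x j)) ∂Measure.pi (coordLaw μ φ α)
        = ∫ y, F (coordZ μ φ α j y) ∂coordLaw μ φ α j :=
    integral_comp_eval (f := fun y => F (coordZ μ φ α j y))
      (hF.comp_aestronglyMeasurable (hmem j).1)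
  rw [law_tilted_prodDensity hj hα', Measure.map_congr (logLR_prodDensity_ae_eq_sum_coordZ hj h hα)]
  refine isNearGaussian_map_sum
    (fun j => (hmem j).comp_measurePreserving (measurePreserving_eval _ j))
    (fun j => (heval j continuous_id).trans (hmean j))
    (iIndepFun_pi fun j => (hmem j).1.aemeasurable) ?_ hC ?_
  · rw [sq_sqrt_mul_sigmaBar]
    refine Finset.sum_congr rfl fun j _ => ?_
    rw [variance_of_integral_eq_zero (hmem j).1.aemeasurable (hmean j)]
    exact heval j (continuous_pow 2)
  · exact (Finset.sum_congr rfl fun j _ => heval j (continuous_abs.pow 3)).trans_le hρ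

theorem InFamily.law_ne (h : InFamily μ φ) :
    law (Measure.pi μ) (prodDensity φ 0) ≠ law (Measure.pi μ) (prodDensity φ 1) := by
  intro heq
  have hprob : IsProbabilityMeasure (law (Measure.pi μ) (prodDensity φ 1)) :=
    (isDensity_pi (h.isDensity 1)).isProbabilityMeasure
  have hpos := h.kl_pos 0 1 zero_ne_one
  rw [heq, InformationTheory.klDiv_self] at hpos
  exact hpos.false

end Product

end BayesChernoff

theorem theorem1_general (C₁ : ℝ) :
    ∃ C₂ C₃ C₄ : ℝ, 0 < C₂ ∧ 0 < C₃ ∧ 0 < C₄ ∧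
      ∀ (n : ℕ) (Ω : Fin n → Type*) [∀ j, MeasurableSpace (Ω j)]
        (μ : (j : Fin n) → Measure (Ω j)) [∀ j, SigmaFinite (μ j)]
        (φ : Fin 2 → (j : Fin n) → Ω j → ℝ),
        (∀ z j, IsDensity (μ j) (φ z j)) →
        (∀ z w, law (Measure.pi μ) (prodDensity φ z) ≪ law (Measure.pi μ) (prodDensity φ w)) →
        law (Measure.pi μ) (prodDensity φ 0) ≠ law (Measure.pi μ) (prodDensity φ 1) →
        (∃! α : ℝ, IsChernoffArgmax (Measure.pi μ) (prodDensity φ 0) (prodDensity φ 1) α) ∧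
        (∀ zhat : ((j : Fin n) → Ω j) → Fin 2, IsBayesEstimator (prodDensity φ) zhat →
          affinity (Measure.pi μ) (prodDensity φ 0) (prodDensity φ 1)
            = 2 * errorProb (Measure.pi μ) (prodDensity φ) zhat) ∧
        ∀ α : ℝ, IsChernoffArgmax (Measure.pi μ) (prodDensity φ 0) (prodDensity φ 1) α →
          ∑ j, ∫ y, |coordZ μ φ α j y| ^ 3 ∂(coordLaw μ φ α j)
            ≤ C₁ * n * sigmaBar μ φ α ^ 2 →
          (expG μ φ α ≤ C₂ / (Real.sqrt n * sigmaBar μ φ α * (1 - α) * α) ∧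
            affinity (Measure.pi μ) (prodDensity φ 0) (prodDensity φ 1)
              ≤ C₂ / (Real.sqrt n * sigmaBar μ φ α * (1 - α) * α) *
                Real.exp (-chernoffInfo (Measure.pi μ) (prodDensity φ 0) (prodDensity φ 1))) ∧
          (C₃ ≤ Real.sqrt n * sigmaBar μ φ α * (1 - α) * α →
            C₄ / (Real.sqrt n * sigmaBar μ φ α * (1 - α) * α) ≤ expG μ φ α ∧
            C₄ / (Real.sqrt n * sigmaBar μ φ α * (1 - α) * α) *
                Real.exp (-chernoffInfo (Measure.pi μ) (prodDensity φ 0) (prodDensity φ 1))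
              ≤ affinity (Measure.pi μ) (prodDensity φ 0) (prodDensity φ 1)) := by
  have hC : 1 ≤ max C₁ 1 := le_max_right _ _
  set C := max C₁ 1
  refine ⟨512 * C, 5 * 96 ^ 3 * C, C * Real.exp (-(4 * (36864 * C))), by positivity,
    by positivity, by positivity, fun n Ω _ μ _ φ hφ hac hne => ?_⟩
  have h : IsEquivPair (Measure.pi μ) (prodDensity φ 0) (prodDensity φ 1) :=
    ⟨isDensity_pi (hφ 0), isDensity_pi (hφ 1), hac 0 1, hac 1 0⟩
  refine ⟨h.existsUnique_isChernoffArgmax hne,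
    fun zhat => affinity_eq_two_mul_errorProb fun z => isDensity_pi (hφ z), fun α hα hρ => ?_⟩
  have hρ' : ∑ j, ∫ y, |coordZ μ φ α j y| ^ 3 ∂coordLaw μ φ α j
      ≤ C * (√n * sigmaBar μ φ α) ^ 2 := by
    rw [mul_pow, Real.sq_sqrt n.cast_nonneg, ← mul_assoc]
    exact hρ.trans (by gcongr; exact le_max_left _ _)
  have := (h.isDensity_tilted (Set.Ioo_subset_Icc_self hα.1)).isProbabilityMeasure
  have := Measure.isProbabilityMeasure_map (μ := law (Measure.pi μ)
    (tilted (Measure.pi μ) (prodDensity φ 0) (prodDensity φ 1) α)) h.measurable_logLR.aemeasurable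
  have hν := isNearGaussian_map_logLR (h.coord hφ) h hα (by positivity) hρ'
  have hs := sqrt_mul_sigmaBar_pos (h.coord hφ) h hne hα.1
  rw [affinity_eq_expG_mul h hα, expG_eq_integral_map h]
  have hup := hν.integral_gFun_le hs hC hα.1
  refine ⟨⟨hup, by gcongr⟩, fun hs' => ?_⟩
  have hlow := hν.le_integral_gFun (by positivity) hα.1 hs'
  exact ⟨hlow, by gcongr⟩

theorem theorem1 (C₁ : ℝ) :
    ∃ C₂ C₃ C₄ : ℝ, 0 < C₂ ∧ 0 < C₃ ∧ 0 < C₄ ∧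
      ∀ (n : ℕ) (Ω : Fin n → Type*) [∀ j, MeasurableSpace (Ω j)]
        (μ : (j : Fin n) → Measure (Ω j)) [∀ j, SigmaFinite (μ j)]
        (φ : Fin 2 → (j : Fin n) → Ω j → ℝ),
        InFamily μ φ →
        (∃! α : ℝ, IsChernoffArgmax (Measure.pi μ) (prodDensity φ 0) (prodDensity φ 1) α) ∧
        (∀ zhat : ((j : Fin n) → Ω j) → Fin 2, IsBayesEstimator (prodDensity φ) zhat →
          affinity (Measure.pi μ) (prodDensity φ 0) (prodDensity φ 1)
            = 2 * errorProb (Measure.pi μ) (prodDensity φ) zhat) ∧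
        ∀ α : ℝ, IsChernoffArgmax (Measure.pi μ) (prodDensity φ 0) (prodDensity φ 1) α →
          ∑ j, ∫ y, |coordZ μ φ α j y| ^ 3 ∂(coordLaw μ φ α j)
            ≤ C₁ * n * sigmaBar μ φ α ^ 2 →
          (expG μ φ α ≤ C₂ / (Real.sqrt n * sigmaBar μ φ α * (1 - α) * α) ∧
            affinity (Measure.pi μ) (prodDensity φ 0) (prodDensity φ 1)
              ≤ C₂ / (Real.sqrt n * sigmaBar μ φ α * (1 - α) * α) *
                Real.exp (-chernoffInfo (Measure.pi μ) (prodDensity φ 0) (prodDensity φ 1))) ∧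
          (C₃ ≤ Real.sqrt n * sigmaBar μ φ α * (1 - α) * α →
            C₄ / (Real.sqrt n * sigmaBar μ φ α * (1 - α) * α) ≤ expG μ φ α ∧
            C₄ / (Real.sqrt n * sigmaBar μ φ α * (1 - α) * α) *
                Real.exp (-chernoffInfo (Measure.pi μ) (prodDensity φ 0) (prodDensity φ 1))
              ≤ affinity (Measure.pi μ) (prodDensity φ 0) (prodDensity φ 1)) := by
  obtain ⟨C₂, C₃, C₄, h₂, h₃, h₄, h⟩ := theorem1_general C₁
  exact ⟨C₂, C₃, C₄, h₂, h₃, h₄, fun n Ω _ μ _ φ hφ =>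
    h n Ω μ φ hφ.isDensity hφ.absolutelyContinuous hφ.law_ne⟩
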